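/- Let $D\subset\mathbb R^2$ be a bounded domain (connected open set) with $\mathcal C^2$ boundary, with outward unit normal $\nu$, let $\kappa>1$, and let $x_1,\dots,x_N$ be distinct points of $\mathbb R^2\setminus\overline D$, serving both as sources and as receivers. Put $\Gamma(x)=\frac1{2\pi}\log|x|$ and $\Gamma_s(x)=\Gamma(x-x_s)$. For each $s$ let $u_s$ be a classical solution of the transmission problem with a point source at $x_s$, $$ \begin{cases} \nabla\cdot\big(1+(\kappa-1)\chi_D\big)\nabla u_s=\delta_{x_s} & \text{in } \mathbb R^2\setminus\partial D,\\ u_s|_+=u_s|_- & \text{on }\partial D,\\ \nu\cdot(\nabla u_s)|_+=\kappa\,\nu\cdot(\nabla u_s)|_- & \text{on }\partial D,\\ u_s(x)-\Gamma_s(x)=O(|x|^{-1}) & \text{as } |x|\to\infty, \end{cases} $$ where $\phi|_\pm(x)=\lim_{t\downarrow0}\phi(x\pm t\nu_x)$ for $x\in\partial D$. Here a classical solution is a function $u_s$ that is $\mathcal C^2$ on $\mathbb R^2\setminus(\partial D\cup\{x_s\})$, such that $u_s$ and $\nabla u_s$ extend continuously to $\partial D$ from each of the two sides and $\nabla u_s$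 is locally integrable on $\mathbb R^2\setminus\partial D$ (also near $x_s$), and that satisfies the first equation in the sense of distributions and the other conditions pointwise. Then $u_s(x_r)=u_r(x_s)$ for all $r\neq s$. Consequently the $N\times N$ multistatic response matrix $\mathbf V$ with entries $V_{rs}=u_s(x_r)-\Gamma_s(x_r)$ (for $r=s$ understood as the limit of $u_s-\Gamma_s$ at $x_s$) is symmetric. -/

import Mathlib

open Set Filter Topology MeasureTheory
open scoped ContDiff

noncomputable section

/-- The Euclidean plane `ℝ²`. -/
abbrev Plane : Type := EuclideanSpace ℝ (Fin 2)

/-- `ρ` is a `C²` local defining function of the open set `D` on the open neighbourhood `U` of the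
point `x`: `D ∩ U = {ρ < 0}`, and the gradient of `ρ` does not vanish on `U`.  If moreover
`x ∈ ∂D`, then `∂D ∩ U = {ρ = 0}` and `∇ρ(x)` points out of `D`. -/
structure IsLocalDefiningFunction (D : Set Plane) (x : Plane) (U : Set Plane)
    (ρ : Plane → ℝ) : Prop where
  isOpen : IsOpen U
  mem : x ∈ U
  contDiffOn : ContDiffOn ℝ 2 ρ U
  gradient_ne_zero : ∀ y ∈ U, gradient ρ y ≠ 0
  inter_eq : D ∩ U = {y | y ∈ U ∧ ρ y < 0}

/-- Bounded `C²` domain of the plane: a bounded, connected open set which near each of its boundary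
points lies on one side of a regular `C²` curve. -/
structure IsBoundedC2Domain (D : Set Plane) : Prop where
  isOpen : IsOpen D
  isConnected : IsConnected D
  isBounded : Bornology.IsBounded D
  exists_definingFunction : ∀ x ∈ frontier D, ∃ U ρ, IsLocalDefiningFunction D x U ρ

/-- `ν` is the outward unit normal of `∂D` at the boundary point `x`. -/
def IsOutwardUnitNormal (D : Set Plane) (x ν : Plane) : Prop :=
  x ∈ frontier D ∧ ‖ν‖ = 1 ∧
    ∃ U ρ, IsLocalDefiningFunction D x U ρ ∧ gradient ρ x = ‖gradient ρ x‖ • ν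

/-- The fundamental solution `Γ(x) = (2π)⁻¹ log |x|` of the Laplace equation in the plane. -/
def fundamentalSolution (x : Plane) : ℝ := 1 / (2 * Real.pi) * Real.log ‖x‖

/-- The conductivity `1 + (κ - 1) χ_D`. -/
def conductivity (κ : ℝ) (D : Set Plane) (x : Plane) : ℝ :=
  1 + (κ - 1) * D.indicator (fun _ => (1 : ℝ)) x

/-- `u` and its gradient extend continuously from the open set `Ω` to `K ⊇ Ω`. -/
def ExtendsC1 (u : Plane → ℝ) (Ω K : Set Plane) : Prop :=
  (∃ v : Plane → ℝ, ContinuousOn v K ∧ EqOn v u Ω) ∧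
    ∃ G : Plane → Plane, ContinuousOn G K ∧ EqOn G (gradient u) Ω

/-- `u` is a (classical) solution of the transmission problem for the inclusion `D` of conductivity
`κ` in a medium of conductivity one, with a point source at `p`. The value of `u` at the
source `p` and on the interface `∂D` carries no information. -/
structure IsTransmissionSolution (κ : ℝ) (D : Set Plane) (p : Plane) (u : Plane → ℝ) : Prop where
  /-- `u` is `C²` away from the interface and the source. -/
  contDiffOn : ContDiffOn ℝ 2 u (frontier D ∪ {p})ᶜ
  /-- `u` is `C¹` up to the interface from the inside. -/
  extends_inside : ExtendsC1 u D (closure D)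
  /-- `u` is `C¹` up to the interface from the outside. -/
  extends_outside : ExtendsC1 u ((closure D)ᶜ \ {p}) (Dᶜ \ {p})
  /-- `∇u` is locally integrable on `ℝ² \ ∂D`, also near the source. -/
  locallyIntegrable : LocallyIntegrableOn (gradient u) (frontier D)ᶜ volume
  /-- `∇ · (1 + (κ - 1) χ_D) ∇u = δ_p` in the sense of distributions on `ℝ² \ ∂D`. -/
  equation : ∀ φ : Plane → ℝ, ContDiff ℝ ∞ φ → HasCompactSupport φ →
    tsupport φ ⊆ (frontier D)ᶜ →
      -∫ x, inner ℝ (conductivity κ D x • gradient u x) (gradient φ x) = φ p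
  /-- `u|₊ = u|₋` on `∂D`. -/
  continuity : ∀ x ν, IsOutwardUnitNormal D x ν → ∃ a : ℝ,
    Tendsto (fun t : ℝ => u (x + t • ν)) (𝓝[>] 0) (𝓝 a) ∧
      Tendsto (fun t : ℝ => u (x - t • ν)) (𝓝[>] 0) (𝓝 a)
  /-- `ν · (∇u)|₊ = κ ν · (∇u)|₋` on `∂D`. -/
  flux : ∀ x ν, IsOutwardUnitNormal D x ν → ∃ b c : ℝ,
    Tendsto (fun t : ℝ => inner ℝ ν (gradient u (x + t • ν))) (𝓝[>] 0) (𝓝 b) ∧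
      Tendsto (fun t : ℝ => inner ℝ ν (gradient u (x - t • ν))) (𝓝[>] 0) (𝓝 c) ∧
        b = κ * c
  /-- `u(x) - Γ(x - p) = O(|x|⁻¹)` at infinity. -/
  decay : (fun x => u x - fundamentalSolution (x - p)) =O[Bornology.cobounded Plane]
    fun x => ‖x‖⁻¹

open Classical in
/-- The multistatic response matrix `V_{rs} = u_s(x_r) - Γ(x_r - x_s)` of the potentials `u_s`
with sources (and receivers) `x_s`. At `r = s` both terms are singular, and the entry is
the limit of the perturbation `u_s - Γ(· - x_s)` at `x_s`. -/
def multistaticResponse {N : ℕ} (x : Fin N → Plane) (u : Fin N → Plane → ℝ) :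
    Matrix (Fin N) (Fin N) ℝ :=
  Matrix.of fun r s =>
    if r = s then limUnder (𝓝[≠] x s) fun y => u s y - fundamentalSolution (y - x s)
    else u s (x r) - fundamentalSolution (x r - x s)

end

/-! Reciprocity is Green's second identity for two potentials `u`, `w` with poles `p`, `q`. With σ
the conductivity, the field u σ∇w − w σ∇u is divergence free away from the interface and the poles,
because σ is scalar and the products ∇u·σ∇w cancel. The transmission conditions make its normal
component continuous across ∂D, so the interface contributes nothing. The pole `p` contributes w(p),
the pole `q` contributes −u(q), and infinity contributes nothing; hence w(p) = u(q).

All of this is done weakly, pairing the field with gradients of compactly supported C¹ functions, so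
no surface measure or divergence theorem on D is used. Three points need an argument.

Interface (`integral_fderiv_apply_eq_zero_across`): test functions are cut off in a layer of
thickness 1/n around {ρ = 0}. The cutoff produces the integral of a continuous function against a
transversal derivative of b(nρ), and such derivatives tend weakly to zero.

Pole (`integral_singular_test`): the equation of `w` must be tested by `u`, which is singular at `p`
and about which only integrability of the gradient is used there. Truncating the values of `u` and
cutting out a much smaller disc makes the error vanish.

Infinity (`tendsto_integral_greenField_ballCutoff`): the decay condition bounds the potentials but
not their gradients. Since u∇w − w∇u = u∇(w − u) − (w − u)∇u and both potentials are harmonic far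
away, Caccioppoli's inequality bounds the flux through the annulus of radius R by a constant times
sup|u| · sup|w − u|. Here u grows at most logarithmically and w − u = O(1/R), so the flux tends to
zero. -/

/-! ### Weak equations: from smooth to C¹ test functions -/

section WeakForm

variable {E : Type*} [NormedAddCommGroup E] [NormedSpace ℝ E] [FiniteDimensional ℝ E]
  [MeasurableSpace E] [BorelSpace E] {μ : Measure E}

/-- A continuous compactly supported field of linear forms, applied to a vector field which is
locally integrable near its support, gives an integrable function. -/
theorem integrable_apply_of_locallyIntegrableOn {A : E → E →L[ℝ] ℝ} {X : E → E} {Ω : Set E}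
    (hX : LocallyIntegrableOn X Ω μ) (hA : Continuous A) (hAc : HasCompactSupport A)
    (hAΩ : tsupport A ⊆ Ω) : Integrable (fun x => A x (X x)) μ := by
  have hXK := hX.integrableOn_compact_subset hAΩ hAc
  obtain ⟨C, hC⟩ := hA.bounded_above_of_compact_support hAc
  have hs : Function.support (fun x => A x (X x)) ⊆ tsupport A := by
    intro x hx
    by_contra h
    exact hx (by simp [image_eq_zero_of_notMem_tsupport h])
  rw [← integrableOn_iff_integrable_of_support_subset hs]
  refine Integrable.mono' (hXK.norm.const_mul C) ?_ ?_
  · exact (ContinuousLinearMap.apply ℝ ℝ).flip.aestronglyMeasurable_comp₂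
      hA.aestronglyMeasurable hXK.aestronglyMeasurable
  · exact Eventually.of_forall fun x => ((A x).le_opNorm _).trans
      (mul_le_mul_of_nonneg_right (hC x) (norm_nonneg _))

theorem integrable_fderiv_apply_of_locallyIntegrableOn {φ : E → ℝ} {X : E → E} {Ω : Set E}
    (hX : LocallyIntegrableOn X Ω μ) (hφ : ContDiff ℝ 1 φ) (hφc : HasCompactSupport φ)
    (hφΩ : tsupport φ ⊆ Ω) : Integrable (fun x => fderiv ℝ φ x (X x)) μ :=
  integrable_apply_of_locallyIntegrableOn hX (hφ.continuous_fderiv one_ne_zero) (hφc.fderiv ℝ)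
    ((tsupport_fderiv_subset ℝ).trans hφΩ)

/-- A compactly supported `C¹` function is a limit in `C¹` of smooth functions with support in any
given neighbourhood of its support. -/
theorem ContDiff.exists_smooth_approx_C1 {φ : E → ℝ} (hφ : ContDiff ℝ 1 φ)
    (hφc : HasCompactSupport φ) {δ ε : ℝ} (hδ : 0 < δ) (hε : 0 < ε) :
    ∃ ψ : E → ℝ, ContDiff ℝ ∞ ψ ∧ tsupport ψ ⊆ Metric.cthickening δ (tsupport φ) ∧
      (∀ x, |ψ x - φ x| ≤ ε) ∧ ∀ x, ‖fderiv ℝ ψ x - fderiv ℝ φ x‖ ≤ ε := by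
  have hu1 := hφ.continuous.uniformContinuous_of_tendsto_cocompact
    hφc.is_zero_at_infty
  have hu2 := (hφ.continuous_fderiv one_ne_zero).uniformContinuous_of_tendsto_cocompact
    (hφc.fderiv ℝ).is_zero_at_infty
  obtain ⟨d1, hd1, h1⟩ := Metric.uniformContinuous_iff.1 hu1 ε hε
  obtain ⟨d2, hd2, h2⟩ := Metric.uniformContinuous_iff.1 hu2 ε hε
  -- The mollification radius is at most δ, for the support, and at most both moduli of uniform
  -- continuity, of φ and of its derivative, for the two estimates.
  set r := min δ (min d1 d2) with hr
  have hr0 : 0 < r := lt_min hδ (lt_min hd1 hd2)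
  let b : ContDiffBump (0 : E) := ⟨r / 2, r, by linarith, by linarith⟩
  let ν : Measure E := Measure.addHaar
  have hbc : HasCompactSupport (b.normed ν) := b.hasCompactSupport_normed
  refine ⟨convolution (b.normed ν) φ (ContinuousLinearMap.lsmul ℝ ℝ) ν, ?_, ?_, ?_, ?_⟩
  · exact hbc.contDiff_convolution_left _ (n := ⊤) b.contDiff_normed
      hφ.continuous.locallyIntegrable
  · refine closure_minimal ((support_convolution_subset _).trans ?_) Metric.isClosed_cthickening
    rintro _ ⟨a, ha, c, hc, rfl⟩
    refine Metric.mem_cthickening_of_dist_le _ c _ _ (subset_tsupport _ hc) ?_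
    rw [b.support_normed_eq, mem_ball_zero_iff] at ha
    simp only [dist_eq_norm, add_sub_cancel_right]
    exact ha.le.trans (min_le_left _ _)
  · intro x
    rw [← Real.dist_eq]
    refine b.dist_normed_convolution_le hφ.continuous.aestronglyMeasurable fun y hy => ?_
    exact (h1 (lt_of_lt_of_le (Metric.mem_ball.1 hy)
      ((min_le_right _ _).trans (min_le_left _ _)))).le
  · intro x
    have := hφc.hasFDerivAt_convolution_right (ContinuousLinearMap.lsmul ℝ ℝ) (μ := ν)
      (f := b.normed ν) b.continuous_normed.locallyIntegrable hφ x
    rw [this.fderiv, ← dist_eq_norm]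
    refine b.dist_normed_convolution_le (μ := ν)
      (hφ.continuous_fderiv one_ne_zero).aestronglyMeasurable fun y hy => ?_
    exact (h2 (lt_of_lt_of_le (Metric.mem_ball.1 hy)
      ((min_le_right _ _).trans (min_le_right _ _)))).le

/-- The weak equation `∇ · X = δ_c`, known for smooth test functions, holds for `C¹` test functions. -/
theorem integral_fderiv_apply_eq_of_smooth {X : E → E} {Ω : Set E} (hΩ : IsOpen Ω)
    (hX : LocallyIntegrableOn X Ω μ) {c : E}
    (h : ∀ φ : E → ℝ, ContDiff ℝ ∞ φ → HasCompactSupport φ → tsupport φ ⊆ Ω →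
      -∫ x, fderiv ℝ φ x (X x) ∂μ = φ c)
    {φ : E → ℝ} (hφ : ContDiff ℝ 1 φ) (hφc : HasCompactSupport φ) (hφΩ : tsupport φ ⊆ Ω) :
    -∫ x, fderiv ℝ φ x (X x) ∂μ = φ c := by
  obtain ⟨δ, hδ, hδΩ⟩ := hφc.isCompact.exists_cthickening_subset_open hΩ hφΩ
  set K := Metric.cthickening δ (tsupport φ)
  have hK : IsCompact K := hφc.isCompact.cthickening
  have hXK := (hX.integrableOn_compact_subset hδΩ hK).norm
  have hφK : tsupport φ ⊆ K := Metric.self_subset_cthickening _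
  set M := ∫ x in K, ‖X x‖ ∂μ with hM
  have hM0 : 0 ≤ M := integral_nonneg fun _ => norm_nonneg _
  -- Replacing φ by its smooth approximation costs ε M in the integral, M being the L¹ norm of X on
  -- K, and ε in the value at c.
  have key : ∀ ε > 0, |(-∫ x, fderiv ℝ φ x (X x) ∂μ) - φ c| ≤ ε * (M + 1) := by
    intro ε hε
    obtain ⟨ψ, hψ, hψK, h1, h2⟩ := hφ.exists_smooth_approx_C1 hφc hδ hε
    have hψc : HasCompactSupport ψ := hK.of_isClosed_subset (isClosed_tsupport _) hψK
    have e := h ψ hψ hψc (hψK.trans hδΩ)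
    have i1 := integrable_fderiv_apply_of_locallyIntegrableOn hX hφ hφc hφΩ
    have i2 := integrable_fderiv_apply_of_locallyIntegrableOn hX (hψ.of_le (by simp)) hψc
      (hψK.trans hδΩ)
    have b : |∫ x, (fderiv ℝ ψ x (X x) - fderiv ℝ φ x (X x)) ∂μ| ≤ ε * M := by
      rw [← setIntegral_eq_integral_of_forall_compl_eq_zero (s := K), hM,
        ← integral_const_mul, ← Real.norm_eq_abs]
      · refine norm_integral_le_of_norm_le (hXK.const_mul ε) (Eventually.of_forall fun x => ?_)
        rw [← sub_apply]
        exact ((fderiv ℝ ψ x - fderiv ℝ φ x).le_opNorm _).trans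
          (mul_le_mul_of_nonneg_right (h2 x) (norm_nonneg _))
      · intro x hx
        have a1 := image_eq_zero_of_notMem_tsupport
          (fun h' => hx (hψK (tsupport_fderiv_subset ℝ h')))
        have a2 := image_eq_zero_of_notMem_tsupport
          (fun h' => hx (hφK (tsupport_fderiv_subset ℝ h')))
        simp [a1, a2]
    rw [integral_sub i2 i1] at b
    have := h1 c
    rw [abs_le] at *
    constructor <;> nlinarith
  have : Tendsto (fun ε : ℝ => ε * (M + 1)) (𝓝[>] 0) (𝓝 0) := by
    have : Tendsto (fun ε : ℝ => ε * (M + 1)) (𝓝 0) (𝓝 (0 * (M + 1))) :=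
      tendsto_id.mul_const _
    simpa using this.mono_left nhdsWithin_le_nhds
  have := ge_of_tendsto this (eventually_mem_nhdsWithin.mono fun ε hε => key ε hε)
  exact sub_eq_zero.1 (abs_nonpos_iff.1 this)

end WeakForm

/-! ### Interfaces with continuous normal flux are removable -/

section Interface

open scoped Manifold in
/-- Smooth cutoff function of a compact set in an open set. -/
theorem IsCompact.exists_smooth_cutoff {E : Type*} [NormedAddCommGroup E] [NormedSpace ℝ E]
    [FiniteDimensional ℝ E] {K Ω : Set E} (hK : IsCompact K) (hΩ : IsOpen Ω) (hKΩ : K ⊆ Ω) :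
    ∃ η : E → ℝ, ContDiff ℝ ∞ η ∧ HasCompactSupport η ∧ tsupport η ⊆ Ω ∧
      (∀ᶠ x in 𝓝ˢ K, η x = 1) ∧ ∀ x, η x ∈ Icc (0 : ℝ) 1 := by
  obtain ⟨L, hL, hKL, hLΩ⟩ := exists_compact_between hK hΩ hKΩ
  obtain ⟨f, h1, h0, hf⟩ := exists_contMDiffMap_one_nhds_of_subset_interior 𝓘(ℝ, E) (n := (⊤ : ℕ∞))
    hK.isClosed hKL
  have hs : tsupport f ⊆ L :=
    closure_minimal (fun x hx => by_contra fun h => hx (h0 x h)) hL.isClosed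
  exact ⟨f, f.contMDiff.contDiff, hL.of_isClosed_subset (isClosed_tsupport _) hs, hs.trans hLΩ,
    h1, hf⟩

/-- Off the level set {ρ = 0} this sends n ρ(x) out of every compact set, so b(nρ) tends to zero
pointwise there when b has compact support. -/
theorem tendsto_natCast_mul_cocompact {c : ℝ} (hc : c ≠ 0) :
    Tendsto (fun n : ℕ => (n : ℝ) * c) atTop (cocompact ℝ) := by
  rw [← Metric.cobounded_eq_cocompact, ← tendsto_norm_atTop_iff_cobounded]
  simp_rw [norm_mul, RCLike.norm_natCast]
  exact tendsto_natCast_atTop_atTop.atTop_mul_const (norm_pos_iff.2 hc)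

theorem abs_arctan_le (t : ℝ) : |Real.arctan t| ≤ Real.pi / 2 :=
  abs_le.2 ⟨by linarith [Real.neg_pi_div_two_lt_arctan t], (Real.arctan_lt_pi_div_two t).le⟩

/-- The function arctan(nρ) is bounded independently of n and increases along e where ∂ₑρ > 0. Its
derivative is therefore a nonnegative density concentrating on {ρ = 0}, whose mass is controlled by
integration by parts. -/
theorem fderiv_arctan_const_mul {E : Type*} [NormedAddCommGroup E]
    [NormedSpace ℝ E] {ρ : E → ℝ} (hρ : ContDiff ℝ 1 ρ) (n : ℝ) (x e : E) :
    fderiv ℝ (fun y => Real.arctan (n * ρ y)) x e =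
      n * fderiv ℝ ρ x e / (1 + (n * ρ x) ^ 2) := by
  have h := ((hρ.differentiable one_ne_zero x).hasFDerivAt.const_mul n).arctan
  rw [h.fderiv]
  simp [div_eq_inv_mul]

theorem fderiv_comp_const_mul {E : Type*} [NormedAddCommGroup E] [NormedSpace ℝ E] {b : ℝ → ℝ}
    (hb : ContDiff ℝ 1 b) {ρ : E → ℝ} (hρ : ContDiff ℝ 1 ρ) (n : ℝ) (x : E) :
    fderiv ℝ (fun y => b (n * ρ y)) x = deriv b (n * ρ x) • (n • fderiv ℝ ρ x) := by
  have h1 : HasDerivAt b (deriv b (n * ρ x)) (n * ρ x) :=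
    (hb.differentiable one_ne_zero _).hasDerivAt
  exact (h1.comp_hasFDerivAt x
    ((hρ.differentiable one_ne_zero x).hasFDerivAt.const_mul n)).fderiv

variable {E : Type*} [NormedAddCommGroup E] [NormedSpace ℝ E] [FiniteDimensional ℝ E]
  [MeasurableSpace E] [BorelSpace E] {μ : Measure E} [μ.IsAddHaarMeasure]

/-- Integration by parts of a `C¹` function against a compactly supported one. -/
theorem integral_mul_fderiv_eq_neg_of_hasCompactSupport {η θ : E → ℝ} (hη : ContDiff ℝ 1 η)
    (hηc : HasCompactSupport η) (hθ : ContDiff ℝ 1 θ) (e : E) :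
    ∫ x, η x * fderiv ℝ θ x e ∂μ = -∫ x, fderiv ℝ η x e * θ x ∂μ := by
  have cη := (hη.continuous_fderiv one_ne_zero).clm_apply (continuous_const (y := e))
  have cθ := (hθ.continuous_fderiv one_ne_zero).clm_apply (continuous_const (y := e))
  refine integral_mul_fderiv_eq_neg_fderiv_mul_of_integrable ?_ ?_ ?_
    (fun x _ => hη.differentiable one_ne_zero x) (fun x _ => hθ.differentiable one_ne_zero x)
  · exact (cη.mul hθ.continuous).integrable_of_hasCompactSupport
      ((hηc.fderiv_apply ℝ e).mul_right)
  · exact (hη.continuous.mul cθ).integrable_of_hasCompactSupport hηc.mul_right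
  · exact (hη.continuous.mul hθ.continuous).integrable_of_hasCompactSupport hηc.mul_right

/-- The layer `{|ρ| ≲ 1/n}` has size `O(1/n)`. -/
theorem integral_mul_layer_le {η ρ : E → ℝ} (hη : ContDiff ℝ 1 η) (hηc : HasCompactSupport η)
    (hρ : ContDiff ℝ 1 ρ) (n : ℝ) (e : E) :
    ∫ x, η x * (n * fderiv ℝ ρ x e / (1 + (n * ρ x) ^ 2)) ∂μ ≤
      Real.pi / 2 * ∫ x, |fderiv ℝ η x e| ∂μ := by
  have hθ : ContDiff ℝ 1 (fun y => Real.arctan (n * ρ y)) := (contDiff_const.mul hρ).arctan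
  simp_rw [← fderiv_arctan_const_mul hρ]
  rw [integral_mul_fderiv_eq_neg_of_hasCompactSupport hη hηc hθ, ← integral_neg,
    ← integral_const_mul]
  have cη := (hη.continuous_fderiv one_ne_zero).clm_apply (continuous_const (y := e))
  refine integral_mono ?_ ?_ fun x => ?_
  · exact ((cη.mul hθ.continuous).integrable_of_hasCompactSupport
      ((hηc.fderiv_apply ℝ e).mul_right)).neg
  · exact ((cη.integrable_of_hasCompactSupport (hηc.fderiv_apply ℝ e)).abs).const_mul _
  · refine (neg_le_abs _).trans ?_
    rw [abs_mul, mul_comm]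
    exact mul_le_mul_of_nonneg_right (abs_arctan_le _) (abs_nonneg _)

/-- A regular level set is a null set. -/
theorem measure_regular_level_eq_zero {ρ : E → ℝ} (hρ : ContDiff ℝ 1 ρ) {V : Set E}
    (hV : IsOpen V) {e : E} (he : ∀ y ∈ V, 0 < fderiv ℝ ρ y e) :
    μ (V ∩ {x | ρ x = 0}) = 0 := by
  refine measure_null_of_locally_null _ fun y hy => ?_
  obtain ⟨r, hr, hrV⟩ := Metric.isOpen_iff.1 hV y hy.1
  let K := Metric.closedBall y (r / 2)
  have hK : IsCompact K := isCompact_closedBall _ _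
  have hKV : K ⊆ V := (Metric.closedBall_subset_ball (by linarith)).trans hrV
  obtain ⟨η, hη, hηc, hηV, hη1, hη01⟩ := hK.exists_smooth_cutoff hV hKV
  have hη' : ContDiff ℝ 1 η := hη.of_le (by simp)
  refine ⟨K ∩ {x | ρ x = 0}, ?_, ?_⟩
  · have : K ∈ 𝓝 y := Metric.closedBall_mem_nhds y (by linarith)
    filter_upwards [nhdsWithin_le_nhds this, self_mem_nhdsWithin] with z hz hz'
    exact ⟨hz, hz'.2⟩
  set S := K ∩ {x | ρ x = 0} with hS
  have hSm : IsClosed S := hK.isClosed.inter (isClosed_eq hρ.continuous continuous_const)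
  have hSc : IsCompact S := hK.of_isClosed_subset hSm inter_subset_left
  have cρ := (hρ.continuous_fderiv one_ne_zero).clm_apply (continuous_const (y := e))
  have hint : IntegrableOn (fun x => fderiv ℝ ρ x e) S μ :=
    cρ.continuousOn.integrableOn_compact hSc
  set C := Real.pi / 2 * ∫ x, |fderiv ℝ η x e| ∂μ
  -- On S the layer density is exactly n ∂ₑρ, and its product with η is nonnegative everywhere. The
  -- layer bound does not depend on n, which forces the integral of the positive function ∂ₑρ over S
  -- to vanish.
  have key : ∀ n : ℕ, n * ∫ x in S, fderiv ℝ ρ x e ∂μ ≤ C := by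
    intro n
    refine le_trans ?_ (integral_mul_layer_le (μ := μ) hη' hηc hρ n e)
    rw [← integral_const_mul, ← integral_indicator hSm.measurableSet]
    refine integral_mono ?_ ?_ fun x => ?_
    · exact (integrable_indicator_iff hSm.measurableSet).2 (Integrable.const_mul hint _)
    · refine Continuous.integrable_of_hasCompactSupport ?_ hηc.mul_right
      refine hη'.continuous.mul ((continuous_const.mul cρ).div ?_ fun x => by positivity)
      exact continuous_const.add ((continuous_const.mul hρ.continuous).pow 2)
    · by_cases hx : x ∈ S
      · have h1 : η x = 1 := hη1.self_of_nhdsSet x hx.1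
        have h0 : ρ x = 0 := hx.2
        simp [hx, h1, h0]
      · simp only [hx, not_false_eq_true, indicator_of_notMem]
        by_cases hxV : x ∈ V
        · have := he x hxV
          have := (hη01 x).1
          positivity
        · have : η x = 0 := image_eq_zero_of_notMem_tsupport fun h => hxV (hηV h)
          simp [this]
  have h0 : ∫ x in S, fderiv ℝ ρ x e ∂μ ≤ 0 := by
    by_contra h
    push Not at h
    obtain ⟨n, hn⟩ := exists_nat_gt (C / ∫ x in S, fderiv ℝ ρ x e ∂μ)
    rw [div_lt_iff₀ h] at hn
    exact absurd (key n) (not_le.2 hn)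
  by_contra hpos
  have hnn : 0 ≤ᵐ[μ.restrict S] fun x => fderiv ℝ ρ x e :=
    (ae_restrict_iff' hSm.measurableSet).2 (Eventually.of_forall fun x hx => (he x (hKV hx.1)).le)
  have := (setIntegral_pos_iff_support_of_nonneg_ae hnn hint).2 (by
    refine (pos_iff_ne_zero.2 hpos).trans_le (measure_mono fun x hx => ⟨?_, hx⟩)
    exact (he x (hKV hx.1)).ne')
  linarith

/-- The derivatives of the functions `b (n ρ)`, concentrating on a regular level set, converge
weakly to zero as measures. -/
theorem tendsto_integral_mul_fderiv_layer {ρ : E → ℝ} (hρ : ContDiff ℝ 1 ρ) {V : Set E}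
    (hV : IsOpen V) {e : E} (he : ∀ y ∈ V, 0 < fderiv ℝ ρ y e) {b : ℝ → ℝ} (hb : ContDiff ℝ 1 b)
    (hbc : HasCompactSupport b) {g : E → ℝ} (hg : Continuous g) (hgc : HasCompactSupport g)
    (hgV : tsupport g ⊆ V) :
    Tendsto (fun n : ℕ => ∫ x, g x * fderiv ℝ (fun y => b (n * ρ y)) x e ∂μ) atTop (𝓝 0) := by
  have hbn : ∀ n : ℕ, ContDiff ℝ 1 fun y => b (n * ρ y) := fun n =>
    hb.comp (contDiff_const.mul hρ)
  have cbn : ∀ n : ℕ, Continuous fun x => fderiv ℝ (fun y => b (n * ρ y)) x e := fun n =>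
    ((hbn n).continuous_fderiv one_ne_zero).clm_apply continuous_const
  have fbn : ∀ (n : ℕ) x, fderiv ℝ (fun y => b (n * ρ y)) x e =
      deriv b (n * ρ x) * (n * fderiv ℝ ρ x e) := by
    intro n x
    rw [fderiv_comp_const_mul hb hρ]
    simp
  obtain ⟨B, hB⟩ := hb.continuous.bounded_above_of_compact_support hbc
  -- With |b'(t)| ≤ M / (1 + t²), the derivative of b(nρ) is dominated by the arctan layer, so its
  -- mass is bounded uniformly in n.
  obtain ⟨M, hM⟩ : ∃ M, ∀ t, ‖deriv b t * (1 + t ^ 2)‖ ≤ M := by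
    have hc : Continuous fun t : ℝ => deriv b t * (1 + t ^ 2) :=
      (hb.continuous_deriv le_rfl).mul (by fun_prop)
    exact hc.bounded_above_of_compact_support hbc.deriv.mul_right
  have hM0 : 0 ≤ M := (norm_nonneg _).trans (hM 0)
  -- smooth test functions
  have smooth : ∀ ψ : E → ℝ, ContDiff ℝ 1 ψ → HasCompactSupport ψ → tsupport ψ ⊆ V →
      Tendsto (fun n : ℕ => ∫ x, ψ x * fderiv ℝ (fun y => b (n * ρ y)) x e ∂μ) atTop (𝓝 0) := by
    intro ψ hψ hψc hψV
    -- Once the derivative falls on ψ, only b(nρ) itself remains: it is bounded by B and tends to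
    -- zero off the null set {ρ = 0}.
    simp_rw [fun n => integral_mul_fderiv_eq_neg_of_hasCompactSupport (μ := μ) hψ hψc (hbn n) e]
    have cψ := (hψ.continuous_fderiv one_ne_zero).clm_apply (continuous_const (y := e))
    rw [← neg_zero, ← integral_zero E ℝ (μ := μ)]
    refine (tendsto_integral_of_dominated_convergence (fun x => |fderiv ℝ ψ x e| * B)
      (fun n => (cψ.mul (hbn n).continuous).aestronglyMeasurable) ?_ (fun n => ?_) ?_).neg
    · exact (cψ.integrable_of_hasCompactSupport (hψc.fderiv_apply ℝ e)).abs.mul_const _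
    · refine Eventually.of_forall fun x => ?_
      exact (norm_mul _ _).trans_le (mul_le_mul_of_nonneg_left (hB _) (abs_nonneg _))
    · have : ∀ᵐ x ∂μ, x ∉ V ∩ {x | ρ x = 0} :=
        measure_eq_zero_iff_ae_notMem.1 (measure_regular_level_eq_zero hρ hV he)
      filter_upwards [this] with x hx
      by_cases hxV : x ∈ V
      · have hx0 : ρ x ≠ 0 := fun h => hx ⟨hxV, h⟩
        have : Tendsto (fun n : ℕ => (n : ℝ) * ρ x) atTop (cocompact ℝ) :=
          tendsto_natCast_mul_cocompact hx0
        simpa using (hbc.is_zero_at_infty.comp this).const_mul (fderiv ℝ ψ x e)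
      · have : fderiv ℝ ψ x = 0 :=
          image_eq_zero_of_notMem_tsupport fun h => hxV (hψV (tsupport_fderiv_subset ℝ h))
        simp [this]
  obtain ⟨η, hη, hηc, hηV, hη1, hη01⟩ := hgc.isCompact.exists_smooth_cutoff hV hgV
  have hη' : ContDiff ℝ 1 η := hη.of_le (by simp)
  set C := Real.pi / 2 * ∫ x, |fderiv ℝ η x e| ∂μ
  have hC : 0 ≤ C := mul_nonneg (by positivity) (integral_nonneg fun _ => abs_nonneg _)
  rw [Metric.tendsto_atTop]
  intro ε hε
  -- Replacing g by a C¹ function ψ within δ costs at most δ M C for every n, which this choice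
  -- keeps below ε / 2; the summand 1 covers M C = 0.
  set δ := ε / (2 * (M * C + 1)) with hδ
  have hδ0 : 0 < δ := by positivity
  obtain ⟨ψ, hψ, hψg, hψs⟩ := hg.exists_contDiff_approx 1 (ε := fun _ => δ) continuous_const
    (fun _ => hδ0)
  have hψt : tsupport ψ ⊆ tsupport g := closure_mono hψs
  have hψc : HasCompactSupport ψ := hgc.isCompact.of_isClosed_subset (isClosed_tsupport _) hψt
  obtain ⟨n0, hn0⟩ := Metric.tendsto_atTop.1 (smooth ψ hψ hψc (hψt.trans hgV)) (ε / 2)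
    (by linarith)
  refine ⟨n0, fun n hn => ?_⟩
  have h1 := hn0 n hn
  have i1 : Integrable (fun x => g x * fderiv ℝ (fun y => b (n * ρ y)) x e) μ :=
    (hg.mul (cbn n)).integrable_of_hasCompactSupport hgc.mul_right
  have i2 : Integrable (fun x => ψ x * fderiv ℝ (fun y => b (n * ρ y)) x e) μ :=
    (hψ.continuous.mul (cbn n)).integrable_of_hasCompactSupport hψc.mul_right
  have h2 : ‖∫ x, (g x * fderiv ℝ (fun y => b (n * ρ y)) x e
      - ψ x * fderiv ℝ (fun y => b (n * ρ y)) x e) ∂μ‖ ≤ δ * M * C := by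
    refine (norm_integral_le_of_norm_le (g := fun x => (δ * M) *
      (η x * (n * fderiv ℝ ρ x e / (1 + (n * ρ x) ^ 2)))) ?_ ?_).trans ?_
    · refine Integrable.const_mul (Continuous.integrable_of_hasCompactSupport ?_ hηc.mul_right) _
      have cρ := (hρ.continuous_fderiv one_ne_zero).clm_apply (continuous_const (y := e))
      refine hη'.continuous.mul ((continuous_const.mul cρ).div ?_ fun x => by positivity)
      exact continuous_const.add ((continuous_const.mul hρ.continuous).pow 2)
    · refine Eventually.of_forall fun x => ?_
      rw [← sub_mul, norm_mul, mul_assoc]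
      by_cases hx : x ∈ tsupport g
      · rw [hη1.self_of_nhdsSet x hx, one_mul]
        have hex := he x (hgV hx)
        refine mul_le_mul ?_ ?_ (norm_nonneg _) hδ0.le
        · rw [norm_sub_rev, ← dist_eq_norm]; exact (hψg x).le
        · have := hM (n * ρ x)
          rw [norm_mul, Real.norm_of_nonneg (by positivity : (0 : ℝ) ≤ 1 + (n * ρ x) ^ 2)] at this
          rw [fbn, norm_mul, Real.norm_of_nonneg (by positivity : (0 : ℝ) ≤ n * fderiv ℝ ρ x e),
            mul_div_assoc', le_div_iff₀ (by positivity)]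
          have h3 : (0 : ℝ) ≤ n * fderiv ℝ ρ x e := by positivity
          nlinarith
      · have a : g x = 0 := image_eq_zero_of_notMem_tsupport hx
        have a' : ψ x = 0 := image_eq_zero_of_notMem_tsupport fun h => hx (hψt h)
        simp only [a, a', sub_self, norm_zero, zero_mul]
        by_cases hxV : x ∈ V
        · have := he x hxV
          have := (hη01 x).1
          positivity
        · have : η x = 0 := image_eq_zero_of_notMem_tsupport fun h => hxV (hηV h)
          simp [this]
    · rw [integral_const_mul]
      exact mul_le_mul_of_nonneg_left (integral_mul_layer_le hη' hηc hρ n e) (by positivity)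
  rw [integral_sub i1 i2] at h2
  have h3 : δ * M * C < ε / 2 := by
    have : δ * (M * C + 1) = ε / 2 := by rw [hδ]; field_simp
    nlinarith
  rw [dist_eq_norm, sub_zero] at h1 ⊢
  have h4 := norm_add_le (∫ x, g x * fderiv ℝ (fun y => b (n * ρ y)) x e ∂μ -
    ∫ x, ψ x * fderiv ℝ (fun y => b (n * ρ y)) x e ∂μ)
    (∫ x, ψ x * fderiv ℝ (fun y => b (n * ρ y)) x e ∂μ)
  rw [sub_add_cancel] at h4
  linarith

/-- **Removability of an interface.** A vector field which is weakly divergence free off a regular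
hypersurface `{ρ = 0}`, and whose normal component is continuous across it, is weakly divergence
free. -/
theorem integral_fderiv_apply_eq_zero_across {ρ : E → ℝ} (hρ : ContDiff ℝ 1 ρ) {V : Set E}
    (hV : IsOpen V) {e : E} (he : ∀ y ∈ V, 0 < fderiv ℝ ρ y e) {X : E → E}
    (hX : LocallyIntegrableOn X V μ) {h : E → ℝ} (hh : ContinuousOn h V)
    (hXh : ∀ x ∈ V, ρ x ≠ 0 → fderiv ℝ ρ x (X x) = h x)
    (hdiv : ∀ φ : E → ℝ, ContDiff ℝ 1 φ → HasCompactSupport φ → tsupport φ ⊆ V ∩ {x | ρ x ≠ 0} →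
      ∫ x, fderiv ℝ φ x (X x) ∂μ = 0)
    {φ : E → ℝ} (hφ : ContDiff ℝ 1 φ) (hφc : HasCompactSupport φ) (hφV : tsupport φ ⊆ V) :
    ∫ x, fderiv ℝ φ x (X x) ∂μ = 0 := by
  let b : ContDiffBump (0 : ℝ) := ⟨1, 2, one_pos, one_lt_two⟩
  have hb : ContDiff ℝ 1 b := b.contDiff
  have hbn : ∀ n : ℕ, ContDiff ℝ 1 fun y => b (n * ρ y) := fun n =>
    hb.comp (contDiff_const.mul hρ)
  have cρ := (hρ.continuous_fderiv one_ne_zero).clm_apply (continuous_const (y := e))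
  -- the continuous function `φ h / ∂ₑρ`
  let g : E → ℝ := fun x => φ x * (h x / fderiv ℝ ρ x e)
  have hgc : HasCompactSupport g := hφc.mul_right
  have hgV : tsupport g ⊆ V := (closure_mono (Function.support_mul_subset_left _ _)).trans hφV
  have hg : Continuous g := by
    rw [continuous_iff_continuousAt]
    intro x
    by_cases hx : x ∈ V
    · exact hφ.continuous.continuousAt.mul ((hh.continuousAt (hV.mem_nhds hx)).div
        cρ.continuousAt (he x hx).ne')
    · have : g =ᶠ[𝓝 x] fun _ => 0 :=
        notMem_tsupport_iff_eventuallyEq.1 fun h' => hx (hgV h')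
      exact continuousAt_const.congr this.symm
  have lim := tendsto_integral_mul_fderiv_layer (μ := μ) hρ hV he hb b.hasCompactSupport hg hgc hgV
  have i0 := integrable_fderiv_apply_of_locallyIntegrableOn hX hφ hφc hφV
  -- As b = 1 near 0, the function φ (1 − b(nρ)) vanishes near the interface and is admissible in
  -- `hdiv`. Differentiating the cutoff gives −φ b'(nρ) n h; writing h = (h / ∂ₑρ) ∂ₑρ turns this
  -- into −g ∂ₑ(b(nρ)).
  have main : ∀ n : ℕ, ∫ x, (1 - b (n * ρ x)) * fderiv ℝ φ x (X x) ∂μ =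
      ∫ x, g x * fderiv ℝ (fun y => b (n * ρ y)) x e ∂μ := by
    intro n
    let φn : E → ℝ := fun x => φ x * (1 - b (n * ρ x))
    have hφn : ContDiff ℝ 1 φn := hφ.mul (contDiff_const.sub (hbn n))
    have hnear : ∀ x, ρ x = 0 → ∀ᶠ y in 𝓝 x, b (n * ρ y) = 1 := by
      intro x hx
      have : Tendsto (fun y => n * ρ y) (𝓝 x) (𝓝 0) := by
        have : ContinuousAt (fun y => n * ρ y) x := (continuous_const.mul hρ.continuous).continuousAt
        simpa [ContinuousAt, hx] using this
      exact this.eventually b.eventuallyEq_one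
    have hφnV : tsupport φn ⊆ V ∩ {x | ρ x ≠ 0} := by
      intro x hx
      refine ⟨hφV (closure_mono (Function.support_mul_subset_left _ _) hx), fun h0 => ?_⟩
      refine (notMem_tsupport_iff_eventuallyEq.2 ?_) hx
      filter_upwards [hnear x h0] with y hy
      simp [φn, hy]
    have hφnc : HasCompactSupport φn := hφc.mul_right
    have e0 := hdiv φn hφn hφnc hφnV
    have e1 : ∀ x, (1 - b (n * ρ x)) * fderiv ℝ φ x (X x) -
        g x * fderiv ℝ (fun y => b (n * ρ y)) x e = fderiv ℝ φn x (X x) := by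
      intro x
      have d1 := (hφ.differentiable one_ne_zero x).hasFDerivAt.mul
        (((hbn n).differentiable one_ne_zero x).hasFDerivAt.const_sub 1)
      have d1' : fderiv ℝ φn x = _ := d1.fderiv
      rw [d1']
      have d2 := fderiv_comp_const_mul hb hρ n x
      by_cases hxV : x ∈ V
      · by_cases h0 : ρ x = 0
        · have : fderiv ℝ (fun y => b (n * ρ y)) x = 0 := by
            rw [EventuallyEq.fderiv_eq (hnear x h0)]; simp
          simp [this]
        · have := (he x hxV).ne'
          rw [d2]
          simp only [g, ← hXh x hxV h0]
          simp only [add_apply, smul_apply, neg_apply, smul_eq_mul]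
          field_simp
          ring
      · have a : φ x = 0 := image_eq_zero_of_notMem_tsupport fun h => hxV (hφV h)
        simp [g, a]
    have i1 : Integrable (fun x => (1 - b (n * ρ x)) * fderiv ℝ φ x (X x)) μ := by
      refine i0.bdd_mul (c := 1) ?_ (Eventually.of_forall fun x => ?_)
      · exact (continuous_const.sub (hbn n).continuous).aestronglyMeasurable
      · rw [Real.norm_of_nonneg (sub_nonneg.2 b.le_one)]
        linarith [b.nonneg (x := n * ρ x)]
    have i2 : Integrable (fun x => g x * fderiv ℝ (fun y => b (n * ρ y)) x e) μ :=
      (hg.mul (((hbn n).continuous_fderiv one_ne_zero).clm_apply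
        continuous_const)).integrable_of_hasCompactSupport hgc.mul_right
    rw [← sub_eq_zero, ← integral_sub i1 i2]
    exact (integral_congr_ae (Eventually.of_forall e1)).trans e0
  simp_rw [← main] at lim
  -- The layer side tends to zero, while the other side tends to the full integral by dominated
  -- convergence, b(nρ) tending to zero almost everywhere on V.
  refine tendsto_nhds_unique ?_ lim
  refine tendsto_integral_of_dominated_convergence (fun x => ‖fderiv ℝ φ x (X x)‖)
    (fun n => ?_) i0.norm (fun n => Eventually.of_forall fun x => ?_) ?_
  · exact (continuous_const.sub (hbn n).continuous).aestronglyMeasurable.mul i0.aestronglyMeasurable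
  · rw [norm_mul]
    refine mul_le_of_le_one_left (norm_nonneg _) ?_
    rw [Real.norm_of_nonneg (sub_nonneg.2 b.le_one)]
    linarith [b.nonneg (x := n * ρ x)]
  · have : ∀ᵐ x ∂μ, x ∉ V ∩ {x | ρ x = 0} :=
      measure_eq_zero_iff_ae_notMem.1 (measure_regular_level_eq_zero hρ hV he)
    filter_upwards [this] with x hx
    by_cases hxV : x ∈ V
    · have hx0 : ρ x ≠ 0 := fun h => hx ⟨hxV, h⟩
      have : Tendsto (fun n : ℕ => (n : ℝ) * ρ x) atTop (cocompact ℝ) :=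
        tendsto_natCast_mul_cocompact hx0
      have := (b.hasCompactSupport.is_zero_at_infty.comp this).const_sub 1
      simpa using this.mul_const (fderiv ℝ φ x (X x))
    · have : fderiv ℝ φ x = 0 :=
        image_eq_zero_of_notMem_tsupport fun h => hxV (hφV (tsupport_fderiv_subset ℝ h))
      simp [this]

end Interface

/-! ### Geometry of C² boundaries -/

section Geometry

theorem eventually_pos_of_fderiv_pos {E : Type*} [NormedAddCommGroup E] [NormedSpace ℝ E]
    {f : E → ℝ} {x v : E} (hf : DifferentiableAt ℝ f x) (h0 : f x = 0)
    (hv : 0 < fderiv ℝ f x v) : ∀ᶠ t : ℝ in 𝓝[>] 0, 0 < f (x + t • v) := by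
  have h1 : HasDerivAt (fun t : ℝ => x + t • v) v 0 := by
    simpa using ((hasDerivAt_id (0 : ℝ)).smul_const v).const_add x
  have h2 : HasDerivAt (fun t : ℝ => f (x + t • v)) (fderiv ℝ f x v) 0 := by
    have hf' : HasFDerivAt f (fderiv ℝ f x) (x + (0 : ℝ) • v) := by simpa using hf.hasFDerivAt
    exact hf'.comp_hasDerivAt (0 : ℝ) h1
  have h3 := (hasDerivAt_iff_tendsto_slope.1 h2).eventually (lt_mem_nhds hv)
  have h4 : 𝓝[>] (0 : ℝ) ≤ 𝓝[≠] 0 := nhdsWithin_mono _ fun t ht => ne_of_gt ht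
  filter_upwards [h4 h3, self_mem_nhdsWithin] with t ht ht0
  have ht0 : 0 < t := ht0
  simp only [slope_def_field, zero_smul, add_zero, h0, sub_zero] at ht
  exact (div_pos_iff_of_pos_right ht0).1 ht

variable {D : Set Plane}

namespace IsLocalDefiningFunction

variable {x : Plane} {U : Set Plane} {ρ : Plane → ℝ}

theorem mem_iff (h : IsLocalDefiningFunction D x U ρ) {y : Plane} (hy : y ∈ U) :
    y ∈ D ↔ ρ y < 0 := by
  have := Set.ext_iff.1 h.inter_eq y
  simpa [hy] using this

theorem contDiffAt (h : IsLocalDefiningFunction D x U ρ) {y : Plane} (hy : y ∈ U) :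
    ContDiffAt ℝ 2 ρ y := h.contDiffOn.contDiffAt (h.isOpen.mem_nhds hy)

/-- The substantial direction uses the nonvanishing gradient: if ρ(y) ≤ 0 and y were not adherent to
D, then ρ ≥ 0 near y and y would be a local minimum of ρ, hence a critical point. -/
theorem mem_closure_iff (h : IsLocalDefiningFunction D x U ρ) {y : Plane} (hy : y ∈ U) :
    y ∈ closure D ↔ ρ y ≤ 0 := by
  constructor
  · intro hc
    by_contra hpos
    have h1 : ∀ᶠ z in 𝓝 y, 0 < ρ z :=
      (h.contDiffAt hy).continuousAt.eventually (lt_mem_nhds (not_le.1 hpos))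
    have h2 := mem_closure_iff_frequently.1 hc
    obtain ⟨z, hzD, hz, hzU⟩ := (h2.and_eventually (h1.and (h.isOpen.mem_nhds hy))).exists
    exact lt_asymm hz ((h.mem_iff hzU).1 hzD)
  · intro hle
    by_contra hc
    have h1 : ∀ᶠ z in 𝓝 y, ρ y ≤ ρ z := by
      filter_upwards [isClosed_closure.isOpen_compl.mem_nhds hc, h.isOpen.mem_nhds hy] with z hz hzU
      have : ¬ ρ z < 0 := fun hlt => hz (subset_closure ((h.mem_iff hzU).2 hlt))
      linarith
    have h2 : fderiv ℝ ρ y = 0 := IsLocalMin.fderiv_eq_zero h1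
    exact h.gradient_ne_zero y hy (by simp [gradient, h2])

theorem mem_frontier_iff (h : IsLocalDefiningFunction D x U ρ) (hD : IsOpen D) {y : Plane}
    (hy : y ∈ U) : y ∈ frontier D ↔ ρ y = 0 := by
  rw [hD.frontier_eq, Set.mem_sdiff, h.mem_closure_iff hy, h.mem_iff hy, not_lt]
  exact ⟨fun h => le_antisymm h.1 h.2, fun h => ⟨h.le, h.ge⟩⟩

end IsLocalDefiningFunction

/-- The normal line enters the exterior in the direction of the outward normal, and the interior in
the opposite one. -/
theorem IsOutwardUnitNormal.eventually_mem (hD : IsOpen D) {x ν : Plane}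
    (h : IsOutwardUnitNormal D x ν) :
    (∀ᶠ t : ℝ in 𝓝[>] 0, x + t • ν ∈ (closure D)ᶜ) ∧ ∀ᶠ t : ℝ in 𝓝[>] 0, x - t • ν ∈ D := by
  obtain ⟨hx, hν, U, ρ, hρ, hg⟩ := h
  have hxU := hρ.mem
  have h0 : ρ x = 0 := (hρ.mem_frontier_iff hD hxU).1 hx
  have hd : DifferentiableAt ℝ ρ x := (hρ.contDiffAt hxU).differentiableAt two_ne_zero
  have hpos : 0 < fderiv ℝ ρ x ν := by
    rw [← inner_gradient_left (𝕜 := ℝ), hg, real_inner_smul_left, real_inner_self_eq_norm_sq, hν]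
    simpa using hρ.gradient_ne_zero x hxU
  have hU : ∀ w : Plane, ∀ᶠ t : ℝ in 𝓝[>] 0, x + t • w ∈ U := by
    intro w
    have hc : Continuous fun t : ℝ => x + t • w := by fun_prop
    have : Tendsto (fun t : ℝ => x + t • w) (𝓝[>] 0) (𝓝 x) := by
      simpa using (hc.tendsto 0).mono_left (nhdsWithin_le_nhds (s := Ioi 0))
    exact this.eventually (hρ.isOpen.mem_nhds hxU)
  constructor
  · filter_upwards [eventually_pos_of_fderiv_pos hd h0 hpos, hU ν] with t ht htU
    rw [mem_compl_iff, hρ.mem_closure_iff htU]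
    exact not_le.2 ht
  · have := eventually_pos_of_fderiv_pos (f := -ρ) (v := -ν) hd.neg (by simp [h0])
      (by rw [fderiv_neg]; simpa using hpos)
    filter_upwards [this, hU (-ν)] with t ht htU
    rw [smul_neg, ← sub_eq_add_neg] at htU ht
    rw [hρ.mem_iff htU]
    simpa using ht

/-- A limit along the normal, from the outside. -/
theorem IsOutwardUnitNormal.tendsto_outside (hD : IsOpen D) {x ν p : Plane}
    (h : IsOutwardUnitNormal D x ν) (hp : p ∉ closure D) :
    Tendsto (fun t : ℝ => x + t • ν) (𝓝[>] 0) (𝓝[(closure D)ᶜ \ {p}] x) := by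
  have hc : Continuous fun t : ℝ => x + t • ν := by fun_prop
  have h1 : Tendsto (fun t : ℝ => x + t • ν) (𝓝[>] 0) (𝓝 x) := by
    simpa using (hc.tendsto 0).mono_left (nhdsWithin_le_nhds (s := Ioi 0))
  have hxp : x ≠ p := fun hxp => hp (hxp ▸ frontier_subset_closure h.1)
  exact tendsto_nhdsWithin_iff.2
    ⟨h1, (h.eventually_mem hD).1.and (h1.eventually (isOpen_ne.mem_nhds hxp))⟩

/-- A limit along the normal, from the inside. -/
theorem IsOutwardUnitNormal.tendsto_inside (hD : IsOpen D) {x ν : Plane}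
    (h : IsOutwardUnitNormal D x ν) :
    Tendsto (fun t : ℝ => x - t • ν) (𝓝[>] 0) (𝓝[D] x) := by
  have hc : Continuous fun t : ℝ => x - t • ν := by fun_prop
  have h1 : Tendsto (fun t : ℝ => x - t • ν) (𝓝[>] 0) (𝓝 x) := by
    simpa using (hc.tendsto 0).mono_left (nhdsWithin_le_nhds (s := Ioi 0))
  exact tendsto_nhdsWithin_iff.2 ⟨h1, (h.eventually_mem hD).2⟩

/-- Near a boundary point, the boundary of a `C²` domain is a regular level set of a globally
defined `C¹` function. -/
theorem IsBoundedC2Domain.exists_patch (hD : IsBoundedC2Domain D) {x : Plane}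
    (hx : x ∈ frontier D) {W : Set Plane} (hW : W ∈ 𝓝 x) :
    ∃ (V : Set Plane) (ρ : Plane → ℝ) (e : Plane), IsOpen V ∧ x ∈ V ∧ V ⊆ W ∧ ContDiff ℝ 1 ρ ∧
      (∀ y ∈ V, 0 < fderiv ℝ ρ y e) ∧ (∀ y ∈ V, y ∈ frontier D ↔ ρ y = 0) ∧
      ∀ y ∈ V, y ∈ frontier D → ∃ ν, IsOutwardUnitNormal D y ν ∧
        gradient ρ y = ‖gradient ρ y‖ • ν := by
  obtain ⟨U, ρ₀, h⟩ := hD.exists_definingFunction x hx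
  obtain ⟨r, hr, hrU⟩ := Metric.nhds_basis_closedBall.mem_iff.1 (h.isOpen.mem_nhds h.mem)
  obtain ⟨η, hη, hηc, hηU, hη1, -⟩ :=
    (isCompact_closedBall x r).exists_smooth_cutoff h.isOpen hrU
  -- The cutoff makes the defining function globally C¹ without changing it near x.
  let ρ : Plane → ℝ := fun y => η y * ρ₀ y
  have hρ : ContDiff ℝ 1 ρ := by
    rw [contDiff_iff_contDiffAt]
    intro y
    by_cases hy : y ∈ U
    · exact (hη.contDiffAt.of_le (by simp)).mul ((h.contDiffAt hy).of_le (by norm_num))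
    · have h0 : ρ =ᶠ[𝓝 y] fun _ => 0 := by
        filter_upwards [notMem_tsupport_iff_eventuallyEq.1 fun h' => hy (hηU h')] with z hz
        simp [ρ, hz]
      exact contDiffAt_const.congr_of_eventuallyEq h0
  have heq : ∀ y ∈ Metric.ball x r, ρ =ᶠ[𝓝 y] ρ₀ := by
    intro y hy
    have := (eventually_nhdsSet_iff_forall.1 hη1) y (Metric.ball_subset_closedBall hy)
    filter_upwards [this] with z hz
    simp [ρ, hz]
  have hxr : x ∈ Metric.ball x r := Metric.mem_ball_self hr
  -- In this direction the derivative of ρ at x is |∇ρ₀(x)|² > 0, and positivity persists nearby by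
  -- continuity of the derivative.
  let e : Plane := gradient ρ₀ x
  have hVo : IsOpen {y | 0 < fderiv ℝ ρ y e} := isOpen_lt continuous_const
    ((hρ.continuous_fderiv one_ne_zero).clm_apply continuous_const)
  have hxe : 0 < fderiv ℝ ρ x e := by
    rw [(heq x hxr).fderiv_eq, ← inner_gradient_left (𝕜 := ℝ), real_inner_self_eq_norm_sq]
    have := norm_pos_iff.2 (h.gradient_ne_zero x h.mem)
    positivity
  refine ⟨Metric.ball x r ∩ {y | 0 < fderiv ℝ ρ y e} ∩ interior W, ρ, e,
    (Metric.isOpen_ball.inter hVo).inter isOpen_interior,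
    ⟨⟨hxr, hxe⟩, mem_interior_iff_mem_nhds.2 hW⟩, fun y hy => interior_subset hy.2, hρ,
    fun y hy => hy.1.2, fun y hy => ?_, fun y hy hyD => ?_⟩
  · rw [(heq y hy.1.1).eq_of_nhds]
    exact h.mem_frontier_iff hD.isOpen (hrU (Metric.ball_subset_closedBall hy.1.1))
  · have hyU := hrU (Metric.ball_subset_closedBall hy.1.1)
    have hg : gradient ρ y = gradient ρ₀ y := (heq y hy.1.1).gradient_eq
    have hg0 : ‖gradient ρ₀ y‖ ≠ 0 := norm_ne_zero_iff.2 (h.gradient_ne_zero y hyU)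
    have hgn : gradient ρ₀ y = ‖gradient ρ₀ y‖ • (‖gradient ρ₀ y‖⁻¹ • gradient ρ₀ y) := by
      rw [smul_smul, mul_inv_cancel₀ hg0, one_smul]
    -- The pair (U, ρ₀) given at x serves as a local defining function at every other point of U
    -- too, so it certifies the normal at y.
    refine ⟨‖gradient ρ₀ y‖⁻¹ • gradient ρ₀ y, ⟨hyD, ?_, U, ρ₀, ⟨h.isOpen, hyU, h.contDiffOn,
      h.gradient_ne_zero, h.inter_eq⟩, hgn⟩, hg ▸ hgn⟩
    rw [norm_smul, norm_inv, norm_norm, inv_mul_cancel₀ hg0]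

/-- The values of `u` and `∇u` on ∂D carry no information; nullity of ∂D keeps them out of every
integral. -/
theorem IsBoundedC2Domain.volume_frontier (hD : IsBoundedC2Domain D) :
    volume (frontier D) = 0 := by
  refine measure_null_of_locally_null _ fun x hx => ?_
  obtain ⟨V, ρ, e, hV, hxV, -, hρ, he, hfr, -⟩ := hD.exists_patch hx univ_mem
  refine ⟨V ∩ {y | ρ y = 0}, ?_, measure_regular_level_eq_zero hρ hV he⟩
  filter_upwards [nhdsWithin_le_nhds (hV.mem_nhds hxV), self_mem_nhdsWithin] with y hy hyD
  exact ⟨hy, (hfr y hy).1 hyD⟩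

end Geometry

/-! ### Currents and potentials of transmission solutions -/

section Solution

variable {κ : ℝ} {D : Set Plane} {p : Plane} {u : Plane → ℝ}

theorem conductivity_of_mem {x : Plane} (hx : x ∈ D) : conductivity κ D x = κ := by
  simp [conductivity, hx]

theorem conductivity_of_notMem {x : Plane} (hx : x ∉ D) : conductivity κ D x = 1 := by
  simp [conductivity, hx]

theorem eventually_conductivity_eq (hD : IsOpen D) {x : Plane} (hx : x ∉ frontier D) :
    ∀ᶠ y in 𝓝 x, conductivity κ D y = conductivity κ D x := by
  by_cases hxD : x ∈ D
  · filter_upwards [hD.mem_nhds hxD] with y hy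
    rw [conductivity_of_mem hy, conductivity_of_mem hxD]
  · have hxc : x ∈ (closure D)ᶜ := fun h => hx (hD.frontier_eq ▸ ⟨h, hxD⟩)
    filter_upwards [isClosed_closure.isOpen_compl.mem_nhds hxc] with y hy
    rw [conductivity_of_notMem fun h => hy (subset_closure h), conductivity_of_notMem hxD]

theorem continuousOn_conductivity (hD : IsOpen D) :
    ContinuousOn (conductivity κ D) (frontier D)ᶜ := fun x hx =>
  (continuousAt_const.congr (EventuallyEq.symm (eventually_conductivity_eq hD hx)) :
    ContinuousAt (conductivity κ D) x).continuousWithinAt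

/-- The current `(1 + (κ - 1) χ_D) ∇u`. -/
noncomputable def current (κ : ℝ) (D : Set Plane) (u : Plane → ℝ) (x : Plane) : Plane :=
  conductivity κ D x • gradient u x

/-- This symmetry, due to the conductivity being scalar, is the cancellation behind Green's
identity. -/
theorem fderiv_apply_current_comm (u w : Plane → ℝ) (x : Plane) :
    fderiv ℝ u x (current κ D w x) = fderiv ℝ w x (current κ D u x) := by
  simp only [current, ← inner_gradient_left (𝕜 := ℝ)]
  rw [real_inner_smul_right, real_inner_smul_right, real_inner_comm]

namespace IsTransmissionSolution

theorem locallyIntegrableOn_current (hD : IsOpen D) (hu : IsTransmissionSolution κ D p u) :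
    LocallyIntegrableOn (current κ D u) (frontier D)ᶜ volume :=
  hu.locallyIntegrable.continuousOn_smul isClosed_frontier.isOpen_compl.isLocallyClosed
    (continuousOn_conductivity hD)

/-- The equation of a solution, tested by `C¹` functions. -/
theorem weak_equation (hD : IsOpen D) (hu : IsTransmissionSolution κ D p u) {φ : Plane → ℝ}
    (hφ : ContDiff ℝ 1 φ) (hφc : HasCompactSupport φ) (hφD : tsupport φ ⊆ (frontier D)ᶜ) :
    -∫ x, fderiv ℝ φ x (current κ D u x) = φ p := by
  refine integral_fderiv_apply_eq_of_smooth isClosed_frontier.isOpen_compl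
    (hu.locallyIntegrableOn_current hD) (fun ψ hψ hψc hψD => ?_) hφ hφc hφD
  rw [← hu.equation ψ hψ hψc hψD]
  simp [inner_gradient_right, current]

/-- The definition of a solution gives integrability only off ∂D. At ∂D the current agrees almost
everywhere, on each side, with a field continuous up to the boundary, and ∂D is a null set. -/
theorem locallyIntegrable_current (hD : IsBoundedC2Domain D) (hp : p ∉ closure D)
    (hu : IsTransmissionSolution κ D p u) : LocallyIntegrable (current κ D u) volume := by
  intro x
  by_cases hx : x ∈ frontier D
  · obtain ⟨-, G₁, hG₁, hG₁u⟩ := hu.extends_inside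
    obtain ⟨-, G₂, hG₂, hG₂u⟩ := hu.extends_outside
    have hxp : {p}ᶜ ∈ 𝓝 x :=
      isOpen_ne.mem_nhds fun hxp => hp (hxp ▸ frontier_subset_closure hx)
    obtain ⟨r, hr, hrp⟩ := Metric.nhds_basis_closedBall.mem_iff.1 hxp
    set K := Metric.closedBall x r
    have hK : IsCompact K := isCompact_closedBall x r
    refine ⟨K, Metric.closedBall_mem_nhds x hr, ?_⟩
    have hae : ∀ᵐ y, y ∉ frontier D := measure_eq_zero_iff_ae_notMem.1 hD.volume_frontier
    have hDc : IsClosed Dᶜ := hD.isOpen.isClosed_compl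
    have h1 : IntegrableOn (current κ D u) (K ∩ closure D) volume := by
      have : IntegrableOn (fun y => κ • G₁ y) (K ∩ closure D) volume :=
        ((hG₁.mono inter_subset_right).const_smul κ).integrableOn_compact
          (hK.inter_right isClosed_closure)
      refine this.congr_fun_ae ((ae_restrict_iff'
        (hK.isClosed.inter isClosed_closure).measurableSet).2 ?_)
      filter_upwards [hae] with y hy hyK
      have hyD : y ∈ D := by
        by_contra h
        exact hy (hD.isOpen.frontier_eq ▸ ⟨hyK.2, h⟩)
      simp only [current, conductivity_of_mem hyD, hG₁u hyD]
    have h2 : IntegrableOn (current κ D u) (K ∩ Dᶜ) volume := by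
      have : IntegrableOn G₂ (K ∩ Dᶜ) volume :=
        (hG₂.mono fun y hy => ⟨hy.2, fun h => hrp hy.1 h⟩).integrableOn_compact
          (hK.inter_right hDc)
      refine this.congr_fun_ae ((ae_restrict_iff' (hK.isClosed.inter hDc).measurableSet).2 ?_)
      filter_upwards [hae] with y hy hyK
      have hyD : y ∈ (closure D)ᶜ \ {p} :=
        ⟨fun h => hy (hD.isOpen.frontier_eq ▸ ⟨h, hyK.2⟩), fun h => hrp hyK.1 h⟩
      simp only [current, conductivity_of_notMem hyK.2, hG₂u hyD, one_smul]
    refine (h1.union h2).mono_set fun y hy => ?_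
    by_cases hyD : y ∈ D
    · exact Or.inl ⟨hy, subset_closure hyD⟩
    · exact Or.inr ⟨hy, hyD⟩
  · exact (hu.locallyIntegrableOn_current hD.isOpen x hx).filter_mono
      (isClosed_frontier.isOpen_compl.nhdsWithin_eq hx).ge

/-- The potential extends continuously across the interface. -/
theorem exists_continuousOn (hD : IsBoundedC2Domain D) (hp : p ∉ closure D)
    (hu : IsTransmissionSolution κ D p u) :
    ∃ v : Plane → ℝ, ContinuousOn v {p}ᶜ ∧ EqOn v u (frontier D ∪ {p})ᶜ := by
  classical
  obtain ⟨⟨v₁, hv₁, hv₁u⟩, -⟩ := hu.extends_inside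
  obtain ⟨⟨v₂, hv₂, hv₂u⟩, -⟩ := hu.extends_outside
  have hD' := hD.isOpen
  refine ⟨fun x => if x ∈ D then v₁ x else v₂ x, ContinuousOn.if ?_ ?_ ?_, ?_⟩
  · rintro x ⟨hxp, hx⟩
    change x ∈ frontier D at hx
    -- The patch serves only to supply a normal at x. Along it the two one-sided limits of `u` are
    -- v₁(x) and v₂(x), and the transmission condition equates them.
    obtain ⟨V, ρ, e, -, hxV, -, -, -, -, hn⟩ := hD.exists_patch hx univ_mem
    obtain ⟨ν, hν, -⟩ := hn x hxV hx
    obtain ⟨a, ha1, ha2⟩ := hu.continuity x ν hν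
    have h2 : Tendsto (fun t : ℝ => u (x + t • ν)) (𝓝[>] 0) (𝓝 (v₂ x)) := by
      have hc : Tendsto v₂ (𝓝[(closure D)ᶜ \ {p}] x) (𝓝 (v₂ x)) :=
        (hv₂ x ⟨fun h => (hD'.frontier_eq ▸ hx).2 h, hxp⟩).mono_left
          (nhdsWithin_mono _ fun y hy => ⟨fun h => hy.1 (subset_closure h), hy.2⟩)
      exact (hc.congr' (eventually_mem_nhdsWithin.mono fun y hy => hv₂u hy)).comp
        (hν.tendsto_outside hD' hp)
    have h1 : Tendsto (fun t : ℝ => u (x - t • ν)) (𝓝[>] 0) (𝓝 (v₁ x)) := by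
      have hc : Tendsto v₁ (𝓝[D] x) (𝓝 (v₁ x)) :=
        (hv₁ x (frontier_subset_closure hx)).mono_left (nhdsWithin_mono _ subset_closure)
      exact (hc.congr' (eventually_mem_nhdsWithin.mono fun y hy => hv₁u hy)).comp
        (hν.tendsto_inside hD')
    rw [tendsto_nhds_unique h1 ha2, tendsto_nhds_unique h2 ha1]
  · exact hv₁.mono inter_subset_right
  · refine hv₂.mono fun x hx => ⟨?_, hx.1⟩
    have : closure Dᶜ = Dᶜ := hD'.isClosed_compl.closure_eq
    exact this ▸ hx.2
  · intro x hx
    by_cases hxD : x ∈ D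
    · simp only [hxD, if_true]
      exact hv₁u hxD
    · simp only [hxD, if_false]
      refine hv₂u ⟨fun h => hx (Or.inl (hD'.frontier_eq ▸ ⟨h, hxD⟩)), fun h => hx (Or.inr h)⟩

/-- The normal component of the current extends continuously across the interface. -/
theorem exists_continuousOn_normal (hD : IsBoundedC2Domain D) (hp : p ∉ closure D)
    (hu : IsTransmissionSolution κ D p u) {V : Set Plane} {ρ : Plane → ℝ} (hρ : ContDiff ℝ 1 ρ)
    (hpV : p ∉ V) (hn : ∀ y ∈ V, y ∈ frontier D → ∃ ν, IsOutwardUnitNormal D y ν ∧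
        gradient ρ y = ‖gradient ρ y‖ • ν) :
    ∃ h : Plane → ℝ, ContinuousOn h V ∧
      ∀ x ∈ V, x ∉ frontier D → fderiv ℝ ρ x (current κ D u x) = h x := by
  classical
  obtain ⟨-, G₁, hG₁, hG₁u⟩ := hu.extends_inside
  obtain ⟨-, G₂, hG₂, hG₂u⟩ := hu.extends_outside
  have hD' := hD.isOpen
  have cρ := hρ.continuous_fderiv one_ne_zero
  refine ⟨fun x => if x ∈ D then fderiv ℝ ρ x (κ • G₁ x) else fderiv ℝ ρ x (G₂ x),
    ContinuousOn.if ?_ ?_ ?_, ?_⟩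
  · rintro x ⟨hxV, hx⟩
    change x ∈ frontier D at hx
    have hxp : x ≠ p := fun h => hpV (h ▸ hxV)
    obtain ⟨ν, hν, hg⟩ := hn x hxV hx
    obtain ⟨b, c, hb, hc, hbc⟩ := hu.flux x ν hν
    have h2 : Tendsto (fun t : ℝ => inner ℝ ν (gradient u (x + t • ν))) (𝓝[>] 0)
        (𝓝 (inner ℝ ν (G₂ x))) := by
      have hc : Tendsto G₂ (𝓝[(closure D)ᶜ \ {p}] x) (𝓝 (G₂ x)) :=
        (hG₂ x ⟨fun h => (hD'.frontier_eq ▸ hx).2 h, hxp⟩).mono_left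
          (nhdsWithin_mono _ fun y hy => ⟨fun h => hy.1 (subset_closure h), hy.2⟩)
      exact tendsto_const_nhds.inner
        ((hc.congr' (eventually_mem_nhdsWithin.mono fun y hy => hG₂u hy)).comp
        (hν.tendsto_outside hD' hp))
    have h1 : Tendsto (fun t : ℝ => inner ℝ ν (gradient u (x - t • ν))) (𝓝[>] 0)
        (𝓝 (inner ℝ ν (G₁ x))) := by
      have hc : Tendsto G₁ (𝓝[D] x) (𝓝 (G₁ x)) :=
        (hG₁ x (frontier_subset_closure hx)).mono_left (nhdsWithin_mono _ subset_closure)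
      exact tendsto_const_nhds.inner
        ((hc.congr' (eventually_mem_nhdsWithin.mono fun y hy => hG₁u hy)).comp
        (hν.tendsto_inside hD'))
    -- Since ∇ρ = |∇ρ| ν, the matching of the two branches is the flux condition multiplied by |∇ρ|.
    simp only [← inner_gradient_left (𝕜 := ℝ)]
    rw [hg, real_inner_smul_left, real_inner_smul_left, real_inner_smul_right,
      tendsto_nhds_unique h1 hc, tendsto_nhds_unique h2 hb, hbc]
  · exact cρ.continuousOn.clm_apply ((hG₁.mono inter_subset_right).const_smul κ)
  · refine cρ.continuousOn.clm_apply (hG₂.mono fun x hx => ⟨?_, fun h => hpV (h ▸ hx.1)⟩)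
    have : closure Dᶜ = Dᶜ := hD'.isClosed_compl.closure_eq
    exact this ▸ hx.2
  · intro x hxV hx
    by_cases hxD : x ∈ D
    · simp only [hxD, if_true, current, conductivity_of_mem hxD, hG₁u hxD]
    · have : x ∈ (closure D)ᶜ \ {p} :=
        ⟨fun h => hx (hD'.frontier_eq ▸ ⟨h, hxD⟩), fun h => hpV (h ▸ hxV)⟩
      simp only [hxD, if_false, current, conductivity_of_notMem hxD, hG₂u this, one_smul]

end IsTransmissionSolution

end Solution

/-! ### Locality of weak divergence-freeness -/

section Locality

theorem ContDiffOn.contDiff_mul_of_tsupport_subset {E : Type*} [NormedAddCommGroup E]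
    [NormedSpace ℝ E] {Ω : Set E} (hΩ : IsOpen Ω) {φ f : E → ℝ} (hf : ContDiffOn ℝ 1 f Ω)
    (hφ : ContDiff ℝ 1 φ) (hφΩ : tsupport φ ⊆ Ω) : ContDiff ℝ 1 fun x => φ x * f x := by
  rw [contDiff_iff_contDiffAt]
  intro x
  by_cases hx : x ∈ Ω
  · exact hφ.contDiffAt.mul (hf.contDiffAt (hΩ.mem_nhds hx))
  · have : (fun x => φ x * f x) =ᶠ[𝓝 x] fun _ => 0 := by
      filter_upwards [notMem_tsupport_iff_eventuallyEq.1 fun h => hx (hφΩ h)] with y hy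
      simp [hy]
    exact contDiffAt_const.congr_of_eventuallyEq this

theorem tsupport_mul_subset_left' {E : Type*} [TopologicalSpace E] (φ f : E → ℝ) :
    tsupport (fun x => φ x * f x) ⊆ tsupport φ :=
  closure_mono (Function.support_mul_subset_left _ _)

open scoped Manifold in
/-- A locally integrable vector field which is weakly divergence free near each point of an open set
is weakly divergence free. -/
theorem integral_fderiv_apply_eq_zero_of_local {E : Type*} [NormedAddCommGroup E]
    [NormedSpace ℝ E] [FiniteDimensional ℝ E] [MeasurableSpace E] [BorelSpace E] {μ : Measure E}
    {X : E → E} {Ω : Set E} (hX : LocallyIntegrableOn X Ω μ)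
    (h : ∀ x ∈ Ω, ∃ V, IsOpen V ∧ x ∈ V ∧ ∀ φ : E → ℝ, ContDiff ℝ 1 φ → HasCompactSupport φ →
      tsupport φ ⊆ V → ∫ x, fderiv ℝ φ x (X x) ∂μ = 0)
    {φ : E → ℝ} (hφ : ContDiff ℝ 1 φ) (hφc : HasCompactSupport φ) (hφΩ : tsupport φ ⊆ Ω) :
    ∫ x, fderiv ℝ φ x (X x) ∂μ = 0 := by
  classical
  choose! V hVo hxV hV using h
  obtain ⟨f, hf⟩ := SmoothPartitionOfUnity.exists_isSubordinate 𝓘(ℝ, E)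
    (isClosed_tsupport φ) (fun x : Ω => V x) (fun x => hVo x x.2)
    (fun x hx => mem_iUnion.2 ⟨⟨x, hφΩ hx⟩, hxV x (hφΩ hx)⟩)
  -- Only finitely many members of the partition meet the compact support of φ, so φ is a finite sum
  -- of test functions, each supported in a single V.
  have hfin := f.locallyFinite.finite_nonempty_inter_compact hφc.isCompact
  set t := hfin.toFinset with ht
  have hfi : ∀ i, ContDiff ℝ 1 (f i) := fun i => (f i).contMDiff.contDiff.of_le (by simp)
  have hsum : ∀ x, φ x = ∑ i ∈ t, φ x * f i x := by
    intro x
    by_cases hx : x ∈ tsupport φ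
    · rw [← Finset.mul_sum]
      have h1 : ∑ᶠ i, f i x = 1 := f.sum_eq_one hx
      rw [finsum_eq_sum_of_support_subset (s := t)] at h1
      · rw [h1, mul_one]
      · intro i hi
        exact (hfin.mem_toFinset).2 ⟨x, hi, hx⟩
    · simp [image_eq_zero_of_notMem_tsupport hx]
  have hsm : ∀ i, ContDiff ℝ 1 fun x => φ x * f i x := fun i => hφ.mul (hfi i)
  have hsc : ∀ i, HasCompactSupport fun x => φ x * f i x := fun i => hφc.mul_right
  have hst : ∀ i, tsupport (fun x => φ x * f i x) ⊆ tsupport φ := fun i =>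
    tsupport_mul_subset_left' _ _
  have hd : ∀ x, fderiv ℝ φ x (X x) = ∑ i ∈ t, fderiv ℝ (fun x => φ x * f i x) x (X x) := by
    intro x
    have e : φ = fun x => ∑ i ∈ t, φ x * f i x := funext hsum
    conv_lhs => rw [e]
    rw [fderiv_fun_sum fun i _ => (hsm i).differentiable one_ne_zero x]
    simp
  simp_rw [hd]
  rw [integral_finsetSum _ fun i _ =>
    integrable_fderiv_apply_of_locallyIntegrableOn hX (hsm i) (hsc i) ((hst i).trans hφΩ)]
  refine Finset.sum_eq_zero fun i _ => hV i i.2 _ (hsm i) (hsc i) ?_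
  exact (closure_mono (Function.support_mul_subset_right _ _)).trans (hf i)

end Locality

/-! ### Green's identity away from the sources -/

section Green

variable {κ : ℝ} {D : Set Plane} {p q : Plane} {u w v v' : Plane → ℝ}

theorem fderiv_mul_apply_eq_zero {E : Type*} [NormedAddCommGroup E] [NormedSpace ℝ E]
    {φ f : E → ℝ} {x : E} (hx : x ∉ tsupport φ) (y : E) :
    fderiv ℝ (fun x => φ x * f x) x y = 0 := by
  have : x ∉ tsupport (fun x => φ x * f x) := fun h => hx (tsupport_mul_subset_left' _ _ h)
  rw [image_eq_zero_of_notMem_tsupport fun h => this (tsupport_fderiv_subset ℝ h)]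
  simp

theorem fderiv_mul_apply {E : Type*} [NormedAddCommGroup E] [NormedSpace ℝ E]
    {φ f : E → ℝ} {x : E} (hφ : DifferentiableAt ℝ φ x) (hf : DifferentiableAt ℝ f x) (y : E) :
    fderiv ℝ (fun x => φ x * f x) x y = φ x * fderiv ℝ f x y + f x * fderiv ℝ φ x y := by
  have h : fderiv ℝ (fun x => φ x * f x) x = _ := (hφ.hasFDerivAt.mul hf.hasFDerivAt).fderiv
  rw [h]
  simp

/-- The Green field `u σ∇w - w σ∇u` of two potentials, in terms of continuous extensions `v`, `v'`
of `u` and `w`. -/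
noncomputable def greenField (κ : ℝ) (D : Set Plane) (u w v v' : Plane → ℝ) (x : Plane) : Plane :=
  v x • current κ D w x - v' x • current κ D u x

theorem greenField_swap (x : Plane) :
    greenField κ D w u v' v x = -greenField κ D u w v v' x := by
  simp [greenField]

theorem isOpen_compl_pair : IsOpen ({p, q}ᶜ : Set Plane) :=
  ((toFinite {p, q}).isClosed).isOpen_compl

theorem locallyIntegrableOn_greenField (hD : IsBoundedC2Domain D) (hp : p ∉ closure D)
    (hq : q ∉ closure D) (hu : IsTransmissionSolution κ D p u)
    (hw : IsTransmissionSolution κ D q w) (hv : ContinuousOn v {p}ᶜ) (hv' : ContinuousOn v' {q}ᶜ) :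
    LocallyIntegrableOn (greenField κ D u w v v') {p, q}ᶜ volume := by
  have hl : IsLocallyClosed ({p, q}ᶜ : Set Plane) := isOpen_compl_pair.isLocallyClosed
  refine LocallyIntegrableOn.sub ?_ ?_
  · exact ((hw.locallyIntegrable_current hD hq).locallyIntegrableOn _).continuousOn_smul hl
      (hv.mono fun x hx h => hx (Or.inl h))
  · exact ((hu.locallyIntegrable_current hD hp).locallyIntegrableOn _).continuousOn_smul hl
      (hv'.mono fun x hx h => hx (Or.inr h))

/-- Green's identity away from the interface and the sources. -/
theorem integral_greenField_off_interface (hD : IsBoundedC2Domain D) (hp : p ∉ closure D)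
    (hq : q ∉ closure D) (hu : IsTransmissionSolution κ D p u)
    (hw : IsTransmissionSolution κ D q w) (hvu : EqOn v u (frontier D ∪ {p})ᶜ)
    (hvw : EqOn v' w (frontier D ∪ {q})ᶜ) {φ : Plane → ℝ} (hφ : ContDiff ℝ 1 φ)
    (hφc : HasCompactSupport φ) (hφΩ : tsupport φ ⊆ (frontier D)ᶜ ∩ {p, q}ᶜ) :
    ∫ x, fderiv ℝ φ x (greenField κ D u w v v' x) = 0 := by
  have hΩ : IsOpen ((frontier D)ᶜ ∩ {p, q}ᶜ) :=
    isClosed_frontier.isOpen_compl.inter isOpen_compl_pair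
  have hup : (frontier D)ᶜ ∩ {p, q}ᶜ ⊆ (frontier D ∪ {p})ᶜ := fun x hx h =>
    h.elim hx.1 fun h => hx.2 (Or.inl h)
  have hwq : (frontier D)ᶜ ∩ {p, q}ᶜ ⊆ (frontier D ∪ {q})ᶜ := fun x hx h =>
    h.elim hx.1 fun h => hx.2 (Or.inr h)
  have hu1 : ContDiffOn ℝ 1 u ((frontier D)ᶜ ∩ {p, q}ᶜ) :=
    (hu.contDiffOn.mono hup).of_le (by norm_num)
  have hw1 : ContDiffOn ℝ 1 w ((frontier D)ᶜ ∩ {p, q}ᶜ) :=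
    (hw.contDiffOn.mono hwq).of_le (by norm_num)
  have c1 := hu1.contDiff_mul_of_tsupport_subset hΩ hφ hφΩ
  have c2 := hw1.contDiff_mul_of_tsupport_subset hΩ hφ hφΩ
  have s1 := (tsupport_mul_subset_left' φ u).trans hφΩ
  have s2 := (tsupport_mul_subset_left' φ w).trans hφΩ
  have e1 := hw.weak_equation hD.isOpen c1 hφc.mul_right (s1.trans inter_subset_left)
  have e2 := hu.weak_equation hD.isOpen c2 hφc.mul_right (s2.trans inter_subset_left)
  have i1 := integrable_fderiv_apply_of_locallyIntegrableOn
    ((hw.locallyIntegrable_current hD hq).locallyIntegrableOn univ) c1 hφc.mul_right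
    (subset_univ _)
  have i2 := integrable_fderiv_apply_of_locallyIntegrableOn
    ((hu.locallyIntegrable_current hD hp).locallyIntegrableOn univ) c2 hφc.mul_right
    (subset_univ _)
  have z1 : φ q = 0 := image_eq_zero_of_notMem_tsupport fun h => (hφΩ h).2 (Or.inr rfl)
  have z2 : φ p = 0 := image_eq_zero_of_notMem_tsupport fun h => (hφΩ h).2 (Or.inl rfl)
  rw [z1, zero_mul, neg_eq_zero] at e1
  rw [z2, zero_mul, neg_eq_zero] at e2
  -- Testing the equation of `w` by φu and that of `u` by φw, then subtracting, cancels φ ∇u·σ∇w.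
  -- There is no source term, as φ vanishes at p and q.
  have key : ∀ x, fderiv ℝ φ x (greenField κ D u w v v' x) =
      fderiv ℝ (fun x => φ x * u x) x (current κ D w x) -
        fderiv ℝ (fun x => φ x * w x) x (current κ D u x) := by
    intro x
    by_cases hx : x ∈ tsupport φ
    · have hxΩ := hφΩ hx
      have dφ := hφ.differentiable one_ne_zero x
      have du := (hu1.contDiffAt (hΩ.mem_nhds hxΩ)).differentiableAt one_ne_zero
      have dw := (hw1.contDiffAt (hΩ.mem_nhds hxΩ)).differentiableAt one_ne_zero
      rw [fderiv_mul_apply dφ du, fderiv_mul_apply dφ dw, fderiv_apply_current_comm u w, greenField,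
        hvu (hup hxΩ), hvw (hwq hxΩ)]
      simp only [map_sub, map_smul, smul_eq_mul]
      ring
    · rw [fderiv_mul_apply_eq_zero hx, fderiv_mul_apply_eq_zero hx,
        image_eq_zero_of_notMem_tsupport fun h => hx (tsupport_fderiv_subset ℝ h)]
      simp
  simp_rw [key]
  rw [integral_sub i1 i2, e1, e2, sub_zero]

/-- Green's identity away from the sources. -/
theorem integral_greenField (hD : IsBoundedC2Domain D) (hp : p ∉ closure D)
    (hq : q ∉ closure D) (hu : IsTransmissionSolution κ D p u)
    (hw : IsTransmissionSolution κ D q w) (hv : ContinuousOn v {p}ᶜ) (hv' : ContinuousOn v' {q}ᶜ)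
    (hvu : EqOn v u (frontier D ∪ {p})ᶜ)
    (hvw : EqOn v' w (frontier D ∪ {q})ᶜ) {φ : Plane → ℝ} (hφ : ContDiff ℝ 1 φ)
    (hφc : HasCompactSupport φ) (hφΩ : tsupport φ ⊆ {p, q}ᶜ) :
    ∫ x, fderiv ℝ φ x (greenField κ D u w v v' x) = 0 := by
  have hX := locallyIntegrableOn_greenField hD hp hq hu hw hv hv'
  refine integral_fderiv_apply_eq_zero_of_local hX (fun x hx => ?_) hφ hφc hφΩ
  by_cases hxD : x ∈ frontier D
  · obtain ⟨V, ρ, e, hVo, hxV, hVΩ, hρ, he, hfr, hn⟩ :=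
      hD.exists_patch hxD (isOpen_compl_pair.mem_nhds hx)
    have hpV : p ∉ V := fun h => hVΩ h (Or.inl rfl)
    have hqV : q ∉ V := fun h => hVΩ h (Or.inr rfl)
    obtain ⟨h₁, hh₁, hh₁u⟩ := hu.exists_continuousOn_normal hD hp hρ hpV hn
    obtain ⟨h₂, hh₂, hh₂w⟩ := hw.exists_continuousOn_normal hD hq hρ hqV hn
    -- The normal component of the Green field is v h₂ − v' h₁, continuous because both potentials
    -- and both normal currents are.
    refine ⟨V, hVo, hxV, fun ψ hψ hψc hψV => integral_fderiv_apply_eq_zero_across hρ hVo he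
      (hX.mono_set hVΩ) (h := fun x => v x * h₂ x - v' x * h₁ x) ?_ (fun y hy hy0 => ?_)
      (fun χ hχ hχc hχV => ?_) hψ hψc hψV⟩
    · exact ((hv.mono fun y hy h => hpV (h ▸ hy)).mul hh₂).sub
        ((hv'.mono fun y hy h => hqV (h ▸ hy)).mul hh₁)
    · have hyD : y ∉ frontier D := fun h => hy0 ((hfr y hy).1 h)
      rw [← hh₁u y hy hyD, ← hh₂w y hy hyD, greenField]
      simp
    · exact integral_greenField_off_interface hD hp hq hu hw hvu hvw hχ hχc
        fun y hy => ⟨fun h => (hχV hy).2 ((hfr y (hχV hy).1).1 h), hVΩ (hχV hy).1⟩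
  · exact ⟨(frontier D)ᶜ ∩ {p, q}ᶜ, isClosed_frontier.isOpen_compl.inter isOpen_compl_pair,
      ⟨hxD, hx⟩, fun ψ hψ hψc hψV =>
        integral_greenField_off_interface hD hp hq hu hw hvu hvw hψ hψc hψV⟩

end Green

/-! ### Contribution of a source -/

section Source

/-- The map s ↦ s / (1 + (cs)²) is a smooth truncation: bounded by 1/c, dominated by |s|, with
derivative in [−1, 1], and tending to s as c → 0. It stands in for any a priori growth bound of the
potential at its pole. -/
theorem hasDerivAt_truncation (c s : ℝ) :
    HasDerivAt (fun s : ℝ => s / (1 + (c * s) ^ 2))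
      ((1 - (c * s) ^ 2) / (1 + (c * s) ^ 2) ^ 2) s := by
  have h1 : HasDerivAt (fun s : ℝ => 1 + (c * s) ^ 2) (2 * (c * s) * c) s := by
    simpa using (((hasDerivAt_id s).const_mul c).pow 2).const_add 1
  have h2 := (hasDerivAt_id s).div h1 (by positivity)
  have h3 : (1 - (c * s) ^ 2) / (1 + (c * s) ^ 2) ^ 2 =
      (1 * (1 + (c * s) ^ 2) - id s * (2 * (c * s) * c)) / (1 + (c * s) ^ 2) ^ 2 := by
    simp only [id]
    ring
  rw [h3]
  exact h2

theorem abs_truncation_le (c s : ℝ) : |s / (1 + (c * s) ^ 2)| ≤ |s| := by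
  rw [abs_div, abs_of_pos (by positivity : 0 < 1 + (c * s) ^ 2)]
  exact div_le_self (abs_nonneg _) (by nlinarith [sq_nonneg (c * s)])

theorem abs_truncation_le_inv {c : ℝ} (hc : 0 < c) (s : ℝ) : |s / (1 + (c * s) ^ 2)| ≤ c⁻¹ := by
  rw [abs_div, abs_of_pos (by positivity : 0 < 1 + (c * s) ^ 2), div_le_iff₀ (by positivity),
    ← div_eq_inv_mul, le_div_iff₀ hc, ← abs_of_pos hc, ← abs_mul, abs_of_pos hc, mul_comm s]
  nlinarith [sq_abs (c * s), sq_nonneg (|c * s| - 1)]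

theorem abs_deriv_truncation_le (c s : ℝ) :
    |(1 - (c * s) ^ 2) / (1 + (c * s) ^ 2) ^ 2| ≤ 1 := by
  rw [abs_div, abs_of_pos (by positivity : 0 < (1 + (c * s) ^ 2) ^ 2), div_le_one (by positivity),
    abs_le]
  constructor <;> nlinarith [sq_nonneg (c * s), sq_nonneg ((c * s) ^ 2)]

/-- A weakly divergence free field, continuous near `p`, may be tested by a function with an
integrable gradient and an isolated singularity at `p`. -/
theorem integral_singular_test {Ω : Set Plane} (hΩ : IsOpen Ω) {p : Plane} {G : Plane → Plane}
    (hG : ContinuousOn G Ω)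
    (hdiv : ∀ φ : Plane → ℝ, ContDiff ℝ 1 φ → HasCompactSupport φ → tsupport φ ⊆ Ω →
      ∫ x, fderiv ℝ φ x (G x) = 0)
    {u : Plane → ℝ} (hu : ContDiffOn ℝ 1 u (Ω \ {p}))
    (hint : LocallyIntegrableOn (gradient u) Ω volume) {η : Plane → ℝ} (hη : ContDiff ℝ 1 η)
    (hηc : HasCompactSupport η) (hηΩ : tsupport η ⊆ Ω) (hη1 : ∀ᶠ x in 𝓝 p, η x = 1) :
    Integrable (fun x => η x * fderiv ℝ u x (G x) + u x * fderiv ℝ η x (G x)) ∧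
      ∫ x, (η x * fderiv ℝ u x (G x) + u x * fderiv ℝ η x (G x)) = 0 := by
  set Ω' := Ω \ {p} with hΩ'
  have hΩo : IsOpen Ω' := hΩ.sdiff isClosed_singleton
  have hp0 : (volume : Measure Plane) {p} = 0 := measure_singleton p
  have hae : ∀ᵐ x : Plane, x ≠ p := measure_eq_zero_iff_ae_notMem.1 hp0
  have du : ∀ x ∈ Ω', DifferentiableAt ℝ u x := fun x hx =>
    (hu.contDiffAt (hΩo.mem_nhds hx)).differentiableAt one_ne_zero
  have cu := hu.continuousOn_fderiv_of_isOpen hΩo le_rfl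
  have cη := hη.continuous_fderiv one_ne_zero
  -- the field `η G`
  have hH : Continuous fun x => η x • G x := by
    rw [continuous_iff_continuousAt]
    intro x
    by_cases hx : x ∈ Ω
    · exact hη.continuous.continuousAt.smul (hG.continuousAt (hΩ.mem_nhds hx))
    · have : (fun x => η x • G x) =ᶠ[𝓝 x] fun _ => 0 := by
        filter_upwards [notMem_tsupport_iff_eventuallyEq.1 fun h => hx (hηΩ h)] with y hy
        simp [hy]
      exact continuousAt_const.congr this.symm
  have hHc : HasCompactSupport fun x => η x • G x := hηc.smul_right
  have hHs : tsupport (fun x => η x • G x) ⊆ Ω :=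
    (closure_mono (Function.support_smul_subset_left _ _)).trans hηΩ
  obtain ⟨M, hM⟩ := hH.bounded_above_of_compact_support hHc
  have i1 : Integrable fun x => η x * fderiv ℝ u x (G x) := by
    have hA : Continuous fun x => innerSL ℝ (η x • G x) := (innerSL ℝ).continuous.comp hH
    have hAc : HasCompactSupport fun x => innerSL ℝ (η x • G x) :=
      hHc.comp_left (g := innerSL ℝ) (map_zero _)
    have hAs : tsupport (fun x => innerSL ℝ (η x • G x)) ⊆ Ω := by
      refine (closure_mono fun x hx => ?_).trans hHs
      intro h0
      have h0 : η x • G x = 0 := h0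
      exact hx (by simp [h0])
    refine (integrable_apply_of_locallyIntegrableOn hint hA hAc hAs).congr
      (Eventually.of_forall fun x => ?_)
    simp only [innerSL_apply_apply]
    rw [real_inner_comm, inner_gradient_left, map_smul, smul_eq_mul]
  have i2 : Integrable fun x => u x * fderiv ℝ η x (G x) := by
    refine Continuous.integrable_of_hasCompactSupport ?_ ?_
    · rw [continuous_iff_continuousAt]
      intro x
      by_cases hx : x ∈ Ω
      · by_cases hxp : x = p
        · have : (fun x => u x * fderiv ℝ η x (G x)) =ᶠ[𝓝 x] fun _ => 0 := by
            rw [hxp]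
            filter_upwards [eventually_eventually_nhds.2 hη1] with y hy
            rw [EventuallyEq.fderiv_eq (f := fun _ => (1 : ℝ)) hy]
            simp
          exact continuousAt_const.congr this.symm
        · exact (du x ⟨hx, hxp⟩).continuousAt.mul
            (cη.continuousAt.clm_apply (hG.continuousAt (hΩ.mem_nhds hx)))
      · have : (fun x => u x * fderiv ℝ η x (G x)) =ᶠ[𝓝 x] fun _ => 0 := by
          filter_upwards [notMem_tsupport_iff_eventuallyEq.1
            fun h => hx (hηΩ (tsupport_fderiv_subset ℝ h))] with y hy
          simp [hy]
        exact continuousAt_const.congr this.symm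
    · refine (hηc.fderiv ℝ).mono fun x hx h0 => hx ?_
      simp [h0]
  refine ⟨i1.add i2, ?_⟩
  -- the cutoffs at `p`
  let ζ : ContDiffBump (0 : Plane) := ⟨1, 2, one_pos, one_lt_two⟩
  have hζ : ContDiff ℝ 1 ζ := ζ.contDiff
  obtain ⟨C, hC⟩ := (hζ.continuous_fderiv one_ne_zero).bounded_above_of_compact_support
    (ζ.hasCompactSupport.fderiv ℝ)
  let N : ℕ → ℝ := fun n => n + 1
  have hN : ∀ n, 0 < N n := fun n => by positivity
  have hNt : Tendsto N atTop atTop := tendsto_atTop_add_const_right _ _ tendsto_natCast_atTop_atTop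
  let Z : ℕ → Plane → ℝ := fun n x => ζ (N n ^ 2 • (x - p))
  have hZ : ∀ n, ContDiff ℝ 1 (Z n) := fun n =>
    hζ.comp (by fun_prop)
  have dZ : ∀ n x, fderiv ℝ (Z n) x = N n ^ 2 • fderiv ℝ ζ (N n ^ 2 • (x - p)) := by
    intro n x
    have h1 : HasFDerivAt (fun x : Plane => N n ^ 2 • (x - p))
        (N n ^ 2 • ContinuousLinearMap.id ℝ Plane) x :=
      ((hasFDerivAt_id x).sub_const p).const_smul (N n ^ 2)
    have h2 := (hζ.differentiable one_ne_zero (N n ^ 2 • (x - p))).hasFDerivAt.comp x h1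
    have h3 : fderiv ℝ (Z n) x = _ := h2.fderiv
    rw [h3]
    ext y
    simp
  -- Truncation at height N is matched with a disc of radius 2 / N²: the cutoff term is at most a
  -- constant times N · N² on an area of order N⁻⁴, so its integral is O(1/N).
  let T : ℕ → ℝ → ℝ := fun n s => s / (1 + ((N n)⁻¹ * s) ^ 2)
  let T' : ℕ → ℝ → ℝ := fun n s => (1 - ((N n)⁻¹ * s) ^ 2) / (1 + ((N n)⁻¹ * s) ^ 2) ^ 2
  have hT : ∀ n, ContDiff ℝ 1 (T n) := fun n =>
    contDiff_id.div (by fun_prop) fun s => by positivity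
  have hT' : ∀ n, Continuous (T' n) := fun n =>
    Continuous.div (by fun_prop) (by fun_prop) fun s => by positivity
  -- The derivative of the test function η (1 − Z n) T n(u), applied to G, is A n − B n on Ω'; B n
  -- isolates the derivative of the cutoff at p.
  let A : ℕ → Plane → ℝ := fun n x => (1 - Z n x) *
    (T' n (u x) * (η x * fderiv ℝ u x (G x)) + T n (u x) * fderiv ℝ η x (G x))
  let B : ℕ → Plane → ℝ := fun n x => T n (u x) * fderiv ℝ (Z n) x (η x • G x)
  have hZ01 : ∀ n x, |1 - Z n x| ≤ 1 := fun n x => by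
    rw [abs_of_nonneg (sub_nonneg.2 ζ.le_one)]
    linarith [ζ.nonneg (x := N n ^ 2 • (x - p))]
  have hGΩ' : ContinuousOn G Ω' := hG.mono sdiff_subset
  have mA : ∀ n, AEStronglyMeasurable (A n) (volume.restrict Ω') := fun n => by
    refine ContinuousOn.aestronglyMeasurable ?_ hΩo.measurableSet
    exact (continuousOn_const.sub (hZ n).continuous.continuousOn).mul
      ((((hT' n).comp_continuousOn hu.continuousOn).mul
        (hη.continuous.continuousOn.mul (cu.clm_apply hGΩ'))).add
      (((hT n).continuous.comp_continuousOn hu.continuousOn).mul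
        (cη.continuousOn.clm_apply hGΩ')))
  have mB : ∀ n, AEStronglyMeasurable (B n) (volume.restrict Ω') := fun n => by
    refine ContinuousOn.aestronglyMeasurable ?_ hΩo.measurableSet
    exact ((hT n).continuous.comp_continuousOn hu.continuousOn).mul
      (((hZ n).continuous_fderiv one_ne_zero).continuousOn.clm_apply hH.continuousOn)
  have bA : ∀ n x, ‖A n x‖ ≤ ‖η x * fderiv ℝ u x (G x)‖ + ‖u x * fderiv ℝ η x (G x)‖ := by
    intro n x
    simp only [A, norm_mul]
    refine mul_le_of_le_one_left (norm_nonneg _) (hZ01 n x) |>.trans ((norm_add_le _ _).trans ?_)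
    refine add_le_add ?_ ?_
    · rw [norm_mul, ← norm_mul (η x)]
      exact mul_le_of_le_one_left (norm_nonneg _) (abs_deriv_truncation_le _ _)
    · rw [norm_mul]
      exact mul_le_mul_of_nonneg_right (abs_truncation_le _ _) (norm_nonneg _)
  have iA : ∀ n, IntegrableOn (A n) Ω' := fun n =>
    Integrable.mono' (i1.norm.add i2.norm).integrableOn (mA n) (Eventually.of_forall (bA n))
  let c : ℕ → ℝ := fun n => N n ^ 3 * (C * M)
  have hC0 : 0 ≤ C := (norm_nonneg _).trans (hC 0)
  have hM0 : 0 ≤ M := (norm_nonneg _).trans (hM 0)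
  have bB : ∀ n x, ‖B n x‖ ≤
      (Metric.closedBall p (2 / N n ^ 2)).indicator (fun _ => c n) x := by
    intro n x
    have := hN n
    by_cases hx : x ∈ Metric.closedBall p (2 / N n ^ 2)
    · rw [indicator_of_mem hx]
      have h1 : ‖T n (u x)‖ ≤ N n := by
        simpa using abs_truncation_le_inv (inv_pos.2 this) (u x)
      have h2 : ‖fderiv ℝ (Z n) x (η x • G x)‖ ≤ N n ^ 2 * C * M := by
        refine (ContinuousLinearMap.le_opNorm _ _).trans (mul_le_mul ?_ (hM x) (norm_nonneg _)
          (by positivity))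
        rw [dZ, norm_smul, Real.norm_of_nonneg (by positivity)]
        exact mul_le_mul_of_nonneg_left (hC _) (by positivity)
      calc ‖B n x‖ = ‖T n (u x)‖ * ‖fderiv ℝ (Z n) x (η x • G x)‖ := norm_mul _ _
        _ ≤ N n * (N n ^ 2 * C * M) := mul_le_mul h1 h2 (norm_nonneg _) this.le
        _ = c n := by simp only [c]; ring
    · rw [indicator_of_notMem hx]
      have h0 : fderiv ℝ ζ (N n ^ 2 • (x - p)) = 0 := by
        refine image_eq_zero_of_notMem_tsupport fun h => hx ?_
        have h := tsupport_fderiv_subset ℝ h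
        rw [ζ.tsupport_eq, mem_closedBall_zero_iff, norm_smul,
          Real.norm_of_nonneg (by positivity)] at h
        rw [Metric.mem_closedBall, dist_eq_norm, le_div_iff₀ (by positivity), mul_comm]
        exact h
      simp [B, dZ, h0]
  have iI : ∀ n, Integrable ((Metric.closedBall p (2 / N n ^ 2)).indicator fun _ => c n) := fun n =>
    (integrable_indicator_iff Metric.isClosed_closedBall.measurableSet).2
      (integrableOn_const (isCompact_closedBall _ _).measure_lt_top.ne)
  have iB : ∀ n, IntegrableOn (B n) Ω' := fun n =>
    Integrable.mono' (iI n).integrableOn (mB n) (Eventually.of_forall (bB n))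
  have hAB : ∀ n, ∫ x in Ω', A n x = ∫ x in Ω', B n x := by
    intro n
    let χ : Plane → ℝ := fun x => η x * (1 - Z n x)
    have hχ : ContDiff ℝ 1 χ := hη.mul (contDiff_const.sub (hZ n))
    have hχc : HasCompactSupport χ := hηc.mul_right
    have hχs : tsupport χ ⊆ tsupport η := tsupport_mul_subset_left' _ _
    have hχΩ' : tsupport χ ⊆ Ω' := by
      intro x hx
      refine ⟨hηΩ (hχs hx), fun hxp => (notMem_tsupport_iff_eventuallyEq.2 ?_) hx⟩
      have hxp : x = p := hxp
      have h1 : Tendsto (fun y : Plane => N n ^ 2 • (y - p)) (𝓝 p) (𝓝 0) := by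
        have : Continuous fun y : Plane => N n ^ 2 • (y - p) := by fun_prop
        simpa using this.tendsto p
      rw [hxp]
      filter_upwards [h1.eventually ζ.eventuallyEq_one] with y hy
      have : Z n y = 1 := hy
      simp [χ, this]
    have hTu : ContDiffOn ℝ 1 (fun x => T n (u x)) Ω' := (hT n).comp_contDiffOn hu
    have hφ := hTu.contDiff_mul_of_tsupport_subset hΩo hχ hχΩ'
    have hφs := tsupport_mul_subset_left' χ fun x => T n (u x)
    have h0 := hdiv _ hφ hχc.mul_right (hφs.trans (hχs.trans hηΩ))
    rw [← setIntegral_eq_integral_of_forall_compl_eq_zero (s := Ω')] at h0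
    · rw [← sub_eq_zero, ← integral_sub (iA n) (iB n), ← h0]
      refine setIntegral_congr_fun hΩo.measurableSet fun x hx => ?_
      have d1 : HasFDerivAt (fun x => T n (u x)) (T' n (u x) • fderiv ℝ u x) x :=
        (hasDerivAt_truncation (N n)⁻¹ (u x)).comp_hasFDerivAt x (du x hx).hasFDerivAt
      have d2 : HasFDerivAt χ _ x := (hη.differentiable one_ne_zero x).hasFDerivAt.mul
        (((hZ n).differentiable one_ne_zero x).hasFDerivAt.const_sub 1)
      simp only [A, B]
      rw [fderiv_mul_apply (hχ.differentiable one_ne_zero x) d1.differentiableAt, d1.fderiv,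
        d2.fderiv]
      simp only [add_apply, smul_apply, neg_apply, smul_eq_mul, map_smul, χ]
      ring
    · intro x hx
      exact fderiv_mul_apply_eq_zero (fun h => hx (hχΩ' h)) _
  have limB : Tendsto (fun n => ∫ x in Ω', B n x) atTop (𝓝 0) := by
    set b := (volume : Measure Plane).real (Metric.ball 0 1)
    have hle : ∀ n, ‖∫ x in Ω', B n x‖ ≤ 4 * C * M * b * (N n)⁻¹ := by
      intro n
      have := hN n
      refine (norm_integral_le_of_norm_le (iI n).integrableOn
        (Eventually.of_forall (bB n))).trans ?_
      refine (setIntegral_le_integral (iI n) (Eventually.of_forall fun x =>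
        indicator_nonneg (fun _ _ => by positivity) x)).trans ?_
      rw [integral_indicator Metric.isClosed_closedBall.measurableSet, setIntegral_const,
        Measure.addHaar_real_closedBall _ _ (by positivity)]
      simp only [smul_eq_mul, finrank_euclideanSpace, Fintype.card_fin, c]
      refine le_of_eq ?_
      field_simp
      ring
    have : Tendsto (fun n => 4 * C * M * b * (N n)⁻¹) atTop (𝓝 0) := by
      simpa using (tendsto_inv_atTop_zero.comp hNt).const_mul (4 * C * M * b)
    exact squeeze_zero_norm hle this
  have limA : Tendsto (fun n => ∫ x in Ω', A n x) atTop
      (𝓝 (∫ x in Ω', (η x * fderiv ℝ u x (G x) + u x * fderiv ℝ η x (G x)))) := by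
    refine tendsto_integral_of_dominated_convergence _ mA (i1.norm.add i2.norm).integrableOn
      (fun n => Eventually.of_forall (bA n)) ?_
    refine (ae_restrict_iff' hΩo.measurableSet).2 (Eventually.of_forall fun x hx => ?_)
    have hxp : 0 < ‖x - p‖ := norm_pos_iff.2 (sub_ne_zero.2 hx.2)
    have lz : Tendsto (fun n => Z n x) atTop (𝓝 0) := by
      have : Tendsto (fun n => N n ^ 2 • (x - p)) atTop (cocompact Plane) := by
        rw [← Metric.cobounded_eq_cocompact, ← tendsto_norm_atTop_iff_cobounded]
        simp_rw [norm_smul]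
        refine Tendsto.atTop_mul_const hxp ?_
        simp_rw [norm_pow]
        exact (tendsto_pow_atTop two_ne_zero).comp (tendsto_norm_atTop_atTop.comp hNt)
      exact ζ.hasCompactSupport.is_zero_at_infty.comp this
    have lc : Tendsto (fun n => ((N n)⁻¹ * u x) ^ 2) atTop (𝓝 0) := by
      simpa using ((tendsto_inv_atTop_zero.comp hNt).mul_const (u x)).pow 2
    have lT : Tendsto (fun n => T n (u x)) atTop (𝓝 (u x)) := by
      have := (tendsto_const_nhds (x := u x)).div (lc.const_add 1) (by norm_num)
      rw [add_zero, div_one] at this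
      exact this
    have lT' : Tendsto (fun n => T' n (u x)) atTop (𝓝 1) := by
      have := (lc.const_sub 1).div ((lc.const_add 1).pow 2) (by norm_num)
      rw [add_zero, sub_zero, one_pow, div_one] at this
      exact this
    simpa using (lz.const_sub 1).mul
      ((lT'.mul_const (η x * fderiv ℝ u x (G x))).add (lT.mul_const (fderiv ℝ η x (G x))))
  simp_rw [hAB] at limA
  have := tendsto_nhds_unique limA limB
  rw [← this]
  refine (setIntegral_eq_integral_of_ae_compl_eq_zero ?_).symm
  filter_upwards [hae] with x hxp hx
  have hxt : x ∉ tsupport η := fun h => hx ⟨hηΩ h, hxp⟩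
  rw [image_eq_zero_of_notMem_tsupport hxt,
    image_eq_zero_of_notMem_tsupport fun h => hxt (tsupport_fderiv_subset ℝ h)]
  simp

variable {κ : ℝ} {D : Set Plane} {p q : Plane} {u w v v' : Plane → ℝ}

/-- Green's identity near a source. -/
theorem integral_greenField_source (hD : IsBoundedC2Domain D) (hp : p ∉ closure D)
    (hu : IsTransmissionSolution κ D p u)
    (hw : IsTransmissionSolution κ D q w) (hvu : EqOn v u (frontier D ∪ {p})ᶜ)
    (hvw : EqOn v' w (frontier D ∪ {q})ᶜ) {η : Plane → ℝ} (hη : ContDiff ℝ 1 η)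
    (hηc : HasCompactSupport η) (hηΩ : tsupport η ⊆ (closure D)ᶜ \ {q})
    (hη1 : ∀ᶠ x in 𝓝 p, η x = 1) :
    Integrable (fun x => fderiv ℝ η x (greenField κ D u w v v' x)) ∧
      ∫ x, fderiv ℝ η x (greenField κ D u w v v' x) = w p := by
  set Ω := (closure D)ᶜ \ {q} with hΩdef
  have hΩ : IsOpen Ω := isClosed_closure.isOpen_compl.sdiff isClosed_singleton
  have hfc : (closure D)ᶜ ⊆ (frontier D)ᶜ := compl_subset_compl.2 frontier_subset_closure
  have hw1 : ContDiffOn ℝ 1 w Ω := (hw.contDiffOn.of_le (by norm_num)).mono fun x hx h =>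
    h.elim (hfc hx.1) hx.2
  have hu1 : ContDiffOn ℝ 1 u (Ω \ {p}) := (hu.contDiffOn.of_le (by norm_num)).mono
    fun x hx h => h.elim (hfc hx.1.1) hx.2
  have hcur : ∀ x ∈ Ω, current κ D w x = gradient w x := fun x hx => by
    rw [current, conductivity_of_notMem fun h => hx.1 (subset_closure h), one_smul]
  have hG : ContinuousOn (current κ D w) Ω := by
    refine ContinuousOn.congr ?_ hcur
    exact (InnerProductSpace.toDual ℝ Plane).symm.continuous.comp_continuousOn
      (hw1.continuousOn_fderiv_of_isOpen hΩ le_rfl)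
  -- The two tests are not alike near p. As `w` is regular there, ηw is an ordinary C¹ test function
  -- for the equation of `u` and yields w(p); ηu is singular at p and needs the singular test.
  obtain ⟨i1, e1⟩ := integral_singular_test hΩ (p := p) hG (fun φ hφ hφc hφΩ => by
      have := hw.weak_equation hD.isOpen hφ hφc fun x hx => hfc (hφΩ hx).1
      rwa [image_eq_zero_of_notMem_tsupport fun h => (hφΩ h).2 rfl, neg_eq_zero] at this)
    hu1 (hu.locallyIntegrable.mono_set fun x hx => hfc hx.1) hη hηc hηΩ hη1
  have c2 := hw1.contDiff_mul_of_tsupport_subset hΩ hη hηΩ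
  have s2 := (tsupport_mul_subset_left' η w).trans hηΩ
  have e2 := hu.weak_equation hD.isOpen c2 hηc.mul_right fun x hx => hfc (s2 hx).1
  have i2 := integrable_fderiv_apply_of_locallyIntegrableOn
    ((hu.locallyIntegrable_current hD hp).locallyIntegrableOn univ) c2 hηc.mul_right
    (subset_univ _)
  rw [hη1.self_of_nhds, one_mul] at e2
  have hae : ∀ᵐ x : Plane, x ≠ p := measure_eq_zero_iff_ae_notMem.1 (measure_singleton p)
  have key : ∀ᵐ x : Plane, (η x * fderiv ℝ u x (current κ D w x) +
      u x * fderiv ℝ η x (current κ D w x)) - fderiv ℝ (fun x => η x * w x) x (current κ D u x) =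
      fderiv ℝ η x (greenField κ D u w v v' x) := by
    filter_upwards [hae] with x hxp
    by_cases hx : x ∈ tsupport η
    · have hxΩ := hηΩ hx
      have hxf := hfc hxΩ.1
      rw [fderiv_mul_apply (hη.differentiable one_ne_zero x)
        ((hw1.contDiffAt (hΩ.mem_nhds hxΩ)).differentiableAt one_ne_zero),
        fderiv_apply_current_comm u w, greenField, hvu fun h => h.elim hxf hxp,
        hvw fun h => h.elim hxf hxΩ.2]
      simp only [map_sub, map_smul, smul_eq_mul]
      ring
    · rw [fderiv_mul_apply_eq_zero hx, image_eq_zero_of_notMem_tsupport hx,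
        image_eq_zero_of_notMem_tsupport fun h => hx (tsupport_fderiv_subset ℝ h)]
      simp
  refine ⟨(i1.sub i2).congr key, ?_⟩
  rw [← integral_congr_ae key, integral_sub i1 i2, e1, zero_sub, e2]

end Source

/-! ### Caccioppoli's inequality -/

section Caccioppoli

theorem ContinuousOn.continuous_mul_of_tsupport_subset {E : Type*} [TopologicalSpace E] {Ω : Set E}
    (hΩ : IsOpen Ω) {k f : E → ℝ} (hf : ContinuousOn f Ω) (hk : Continuous k)
    (hkΩ : tsupport k ⊆ Ω) : Continuous fun x => k x * f x := by
  rw [continuous_iff_continuousAt]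
  intro x
  by_cases hx : x ∈ Ω
  · exact hk.continuousAt.mul (hf.continuousAt (hΩ.mem_nhds hx))
  · have : (fun x => k x * f x) =ᶠ[𝓝 x] fun _ => 0 := by
      filter_upwards [notMem_tsupport_iff_eventuallyEq.1 fun h => hx (hkΩ h)] with y hy
      simp [hy]
    exact continuousAt_const.congr this.symm

variable {Ω : Set Plane} {f g η φ : Plane → ℝ}

theorem ContDiffOn.continuousOn_gradient (hΩ : IsOpen Ω) (hg : ContDiffOn ℝ 1 g Ω) :
    ContinuousOn (gradient g) Ω :=
  (InnerProductSpace.toDual ℝ Plane).symm.continuous.comp_continuousOn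
    (hg.continuousOn_fderiv_of_isOpen hΩ le_rfl)

/-- **Caccioppoli's inequality** for weakly harmonic functions, together with the integrability of
its left-hand side. -/
theorem integral_sq_mul_norm_gradient_sq_le (hΩ : IsOpen Ω) (hg : ContDiffOn ℝ 1 g Ω)
    (hdiv : ∀ φ : Plane → ℝ, ContDiff ℝ 1 φ → HasCompactSupport φ → tsupport φ ⊆ Ω →
      ∫ x, fderiv ℝ φ x (gradient g x) = 0)
    (hη : ContDiff ℝ 1 η) (hηc : HasCompactSupport η) (hηΩ : tsupport η ⊆ Ω) :
    Integrable (fun x => η x ^ 2 * ‖gradient g x‖ ^ 2) ∧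
      Integrable (fun x => ‖fderiv ℝ η x‖ ^ 2 * g x ^ 2) ∧
      ∫ x, η x ^ 2 * ‖gradient g x‖ ^ 2 ≤ 4 * ∫ x, ‖fderiv ℝ η x‖ ^ 2 * g x ^ 2 := by
  have cg := hg.continuousOn_gradient hΩ
  have cη := hη.continuous_fderiv one_ne_zero
  have hη2 : ContDiff ℝ 1 fun x => η x ^ 2 := hη.pow 2
  have s2 : tsupport (fun x => η x ^ 2) ⊆ tsupport η :=
    closure_mono fun x hx h0 => hx (by simp [h0])
  have hη2c : HasCompactSupport fun x => η x ^ 2 :=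
    hηc.isCompact.of_isClosed_subset (isClosed_tsupport _) s2
  have s3 : tsupport (fun x => ‖fderiv ℝ η x‖ ^ 2) ⊆ tsupport η := by
    have : Function.support (fun x => ‖fderiv ℝ η x‖ ^ 2) ⊆ Function.support (fderiv ℝ η) :=
      fun x hx h0 => hx (by simp [h0])
    exact (closure_mono this).trans (tsupport_fderiv_subset ℝ)
  have hη3c : HasCompactSupport fun x => ‖fderiv ℝ η x‖ ^ 2 :=
    hηc.isCompact.of_isClosed_subset (isClosed_tsupport _) s3
  have i1 : Integrable (fun x => η x ^ 2 * ‖gradient g x‖ ^ 2) :=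
    (ContinuousOn.continuous_mul_of_tsupport_subset hΩ (cg.norm.pow 2) hη2.continuous
      (s2.trans hηΩ)).integrable_of_hasCompactSupport hη2c.mul_right
  have i2 : Integrable (fun x => ‖fderiv ℝ η x‖ ^ 2 * g x ^ 2) :=
    (ContinuousOn.continuous_mul_of_tsupport_subset hΩ (hg.continuousOn.pow 2) (cη.norm.pow 2)
      (s3.trans hηΩ)).integrable_of_hasCompactSupport hη3c.mul_right
  refine ⟨i1, i2, ?_⟩
  have hφ := hg.contDiff_mul_of_tsupport_subset hΩ hη2 (s2.trans hηΩ)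
  have sφ := (tsupport_mul_subset_left' (fun x => η x ^ 2) g).trans (s2.trans hηΩ)
  have e0 := hdiv _ hφ hη2c.mul_right sφ
  have i3 := integrable_fderiv_apply_of_locallyIntegrableOn
    (cg.locallyIntegrableOn (μ := volume) hΩ.measurableSet) hφ hη2c.mul_right sφ
  -- The test function is η²g. The integrand reduces to −2ηg ∇η·∇g, and Young's inequality bounds it
  -- by ½η²|∇g|² + 2|∇η|²g²; absorbing the first term gives the factor 4.
  have hle : ∫ x, (η x ^ 2 * ‖gradient g x‖ ^ 2 -
      fderiv ℝ (fun x => η x ^ 2 * g x) x (gradient g x)) ≤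
      ∫ x, (1 / 2 * (η x ^ 2 * ‖gradient g x‖ ^ 2) + 2 * (‖fderiv ℝ η x‖ ^ 2 * g x ^ 2)) := by
    refine integral_mono (i1.sub i3) ((i1.const_mul _).add (i2.const_mul _)) fun x => ?_
    by_cases hx : x ∈ tsupport η
    · have d1 := (hη.differentiable one_ne_zero x)
      have d2 := (hg.contDiffAt (hΩ.mem_nhds (hηΩ hx))).differentiableAt one_ne_zero
      have d3 : fderiv ℝ (fun x => η x ^ 2) x = (2 * η x) • fderiv ℝ η x := by
        have := (d1.hasFDerivAt.pow 2).fderiv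
        simpa using this
      simp only
      rw [fderiv_mul_apply (hη2.differentiable one_ne_zero x) d2, d3,
        ← inner_gradient_left (𝕜 := ℝ) (f := g), real_inner_self_eq_norm_sq, smul_apply,
        smul_eq_mul]
      have h1 := (fderiv ℝ η x).le_opNorm (gradient g x)
      rw [Real.norm_eq_abs] at h1
      set a := fderiv ℝ η x (gradient g x)
      set b := ‖gradient g x‖
      set c := ‖fderiv ℝ η x‖
      have h2 : -(g x * η x * a) ≤ |g x| * |η x| * (c * b) := by
        refine (neg_le_abs _).trans ?_
        rw [abs_mul, abs_mul]
        exact mul_le_mul_of_nonneg_left h1 (by positivity)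
      have h3 := sq_nonneg (|η x| * b - 2 * (|g x| * c))
      have h4 := sq_abs (η x)
      have h5 := sq_abs (g x)
      have h6 : (|η x| * b - 2 * (|g x| * c)) ^ 2 =
          η x ^ 2 * b ^ 2 - 4 * (|g x| * |η x| * (c * b)) + 4 * (c ^ 2 * g x ^ 2) := by
        rw [← h4, ← h5]; ring
      nlinarith
    · have h2 : fderiv ℝ (fun x => η x ^ 2 * g x) x (gradient g x) = 0 :=
        fderiv_mul_apply_eq_zero (fun h => hx (s2 h)) _
      simp only
      rw [h2, image_eq_zero_of_notMem_tsupport hx]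
      simp only [ne_eq, OfNat.ofNat_ne_zero, not_false_eq_true, zero_pow, zero_mul, sub_zero,
        mul_zero, zero_add]
      positivity
  rw [integral_sub i1 i3, e0, integral_add (i1.const_mul _) (i2.const_mul _), integral_const_mul,
    integral_const_mul] at hle
  linarith

/-- Consequence of Caccioppoli's inequality on an annular region: no derivative of `g` is needed to
bound `∫ f ∇φ · ∇g`. -/
theorem abs_integral_mul_fderiv_gradient_le (hΩ : IsOpen Ω)
    (hg : ContDiffOn ℝ 1 g Ω)
    (hdiv : ∀ φ : Plane → ℝ, ContDiff ℝ 1 φ → HasCompactSupport φ → tsupport φ ⊆ Ω →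
      ∫ x, fderiv ℝ φ x (gradient g x) = 0)
    (hη : ContDiff ℝ 1 η) (hηc : HasCompactSupport η) (hηΩ : tsupport η ⊆ Ω)
    (hφη : ∀ x, fderiv ℝ φ x ≠ 0 → η x = 1) {a m M : ℝ}
    (hm : 0 < m) (hM : 0 ≤ M) (hφa : ∀ x, ‖fderiv ℝ φ x‖ ≤ a) (hηa : ∀ x, ‖fderiv ℝ η x‖ ≤ a)
    (hfM : ∀ x ∈ tsupport η, |f x| ≤ M) (hgm : ∀ x ∈ tsupport η, |g x| ≤ m) :
    |∫ x, f x * fderiv ℝ φ x (gradient g x)| ≤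
      5 / 2 * M * m * (a ^ 2 * volume.real (tsupport η)) := by
  obtain ⟨i1, i2, hle⟩ := integral_sq_mul_norm_gradient_sq_le hΩ hg hdiv hη hηc hηΩ
  have ha : 0 ≤ a := (norm_nonneg _).trans (hφa 0)
  set S := tsupport η with hS
  have hSm : MeasurableSet S := (isClosed_tsupport η).measurableSet
  have iI : ∀ c : ℝ, Integrable (S.indicator fun _ => c) volume := fun c =>
    (integrable_indicator_iff hSm).2 (integrableOn_const hηc.isCompact.measure_lt_top.ne)
  have eI : ∀ c : ℝ, ∫ x, S.indicator (fun _ => c) x = volume.real S * c := fun c => by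
    rw [integral_indicator hSm, setIntegral_const, smul_eq_mul]
  have h1 : ∫ x, ‖fderiv ℝ η x‖ ^ 2 * g x ^ 2 ≤ volume.real S * (a ^ 2 * m ^ 2) := by
    rw [← eI]
    refine integral_mono i2 (iI _) fun x => ?_
    by_cases hx : x ∈ S
    · simp only [indicator_of_mem hx]
      exact mul_le_mul (pow_le_pow_left₀ (norm_nonneg _) (hηa x) 2)
        (sq_le_sq' (abs_le.1 (hgm x hx)).1 (abs_le.1 (hgm x hx)).2) (sq_nonneg _) (sq_nonneg _)
    · simp only [indicator_of_notMem hx]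
      rw [image_eq_zero_of_notMem_tsupport fun h => hx (tsupport_fderiv_subset ℝ h)]
      simp
  -- Young's inequality a|∇g| ≤ |∇g|² / (2m) + m a² / 2 is weighted by the bound m of g, so that
  -- after Caccioppoli both terms are multiples of m a²|S|, with coefficients 2 and 1/2 adding up to
  -- 5/2.
  have h2 : ∀ x, ‖f x * fderiv ℝ φ x (gradient g x)‖ ≤
      M * ((2 * m)⁻¹ * (η x ^ 2 * ‖gradient g x‖ ^ 2) + S.indicator (fun _ => m / 2 * a ^ 2) x) := by
    intro x
    by_cases hx : fderiv ℝ φ x = 0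
    · rw [hx]
      simp only [zero_apply, mul_zero, norm_zero]
      have := indicator_nonneg (s := S) (f := fun _ => m / 2 * a ^ 2) (fun _ _ => by positivity) x
      positivity
    · have hηx := hφη x hx
      have hxS : x ∈ S := subset_tsupport η (by simp [hηx])
      rw [indicator_of_mem hxS, hηx, norm_mul, one_pow, one_mul]
      refine mul_le_mul (hfM x hxS) ?_ (norm_nonneg _) hM
      refine ((fderiv ℝ φ x).le_opNorm _).trans
        ((mul_le_mul_of_nonneg_right (hφa x) (norm_nonneg _)).trans ?_)
      have h3 : (2 * m)⁻¹ * ‖gradient g x‖ ^ 2 + m / 2 * a ^ 2 - a * ‖gradient g x‖ =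
          (2 * m)⁻¹ * (‖gradient g x‖ - m * a) ^ 2 := by
        field_simp
        ring
      have : 0 ≤ (2 * m)⁻¹ * (‖gradient g x‖ - m * a) ^ 2 := by positivity
      linarith
  have h4 := norm_integral_le_of_norm_le (((i1.const_mul (2 * m)⁻¹).add (iI _)).const_mul M)
    (Eventually.of_forall h2)
  rw [Real.norm_eq_abs, integral_const_mul] at h4
  simp only [Pi.add_apply] at h4
  rw [integral_add (i1.const_mul _) (iI _), eI, integral_const_mul] at h4
  refine h4.trans ?_
  have h5 : (2 * m)⁻¹ * ∫ x, η x ^ 2 * ‖gradient g x‖ ^ 2 ≤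
      (2 * m)⁻¹ * (4 * (volume.real S * (a ^ 2 * m ^ 2))) :=
    mul_le_mul_of_nonneg_left (hle.trans (by linarith)) (by positivity)
  have h6 : (2 * m)⁻¹ * (4 * (volume.real S * (a ^ 2 * m ^ 2))) =
      2 * m * (a ^ 2 * volume.real S) := by
    field_simp
    ring
  rw [h6] at h5
  calc _ ≤ M * (2 * m * (a ^ 2 * volume.real S) + volume.real S * (m / 2 * a ^ 2)) :=
        mul_le_mul_of_nonneg_left (by linarith) hM
    _ = _ := by ring

end Caccioppoli

/-! ### Cutoffs at infinity and annular integrals -/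

section Infinity

/-- A cutoff function, equal to one on the ball of radius `R` and supported in the ball of radius
`2 R`. -/
noncomputable def ballCutoff (R : ℝ) (x : Plane) : ℝ :=
  (⟨1, 2, one_pos, one_lt_two⟩ : ContDiffBump (0 : Plane)) (R⁻¹ • x)

theorem contDiff_ballCutoff (R : ℝ) : ContDiff ℝ ∞ (ballCutoff R) :=
  (ContDiffBump.contDiff _).comp (by fun_prop)

theorem ballCutoff_eq_one {R : ℝ} (hR : 0 < R) {x : Plane} (hx : ‖x‖ ≤ R) : ballCutoff R x = 1 := by
  refine ContDiffBump.one_of_mem_closedBall _ ?_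
  rw [mem_closedBall_zero_iff, norm_smul, norm_inv, Real.norm_of_nonneg hR.le, inv_mul_le_iff₀ hR]
  simpa using hx

theorem ballCutoff_eq_zero {R : ℝ} (hR : 0 < R) {x : Plane} (hx : 2 * R ≤ ‖x‖) :
    ballCutoff R x = 0 := by
  refine ContDiffBump.zero_of_le_dist _ ?_
  rw [dist_zero_right, norm_smul, norm_inv, Real.norm_of_nonneg hR.le, ← div_eq_inv_mul,
    le_div_iff₀ hR]
  exact hx

theorem tsupport_ballCutoff_subset {R : ℝ} (hR : 0 < R) :
    tsupport (ballCutoff R) ⊆ Metric.closedBall 0 (2 * R) := by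
  refine closure_minimal (fun x hx => ?_) Metric.isClosed_closedBall
  by_contra h
  rw [mem_closedBall_zero_iff, not_le] at h
  exact hx (ballCutoff_eq_zero hR h.le)

theorem hasCompactSupport_ballCutoff {R : ℝ} (hR : 0 < R) : HasCompactSupport (ballCutoff R) :=
  (isCompact_closedBall _ _).of_isClosed_subset (isClosed_tsupport _)
    (tsupport_ballCutoff_subset hR)

theorem fderiv_ballCutoff_eq_zero {R : ℝ} (hR : 0 < R) {x : Plane}
    (hx : ‖x‖ < R ∨ 2 * R < ‖x‖) : fderiv ℝ (ballCutoff R) x = 0 := by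
  rcases hx with hx | hx
  · have : ballCutoff R =ᶠ[𝓝 x] fun _ => (1 : ℝ) := by
      filter_upwards [(isOpen_lt continuous_norm continuous_const).mem_nhds hx] with y hy
      exact ballCutoff_eq_one hR (le_of_lt hy)
    rw [this.fderiv_eq]
    simp
  · exact image_eq_zero_of_notMem_tsupport fun h => by
      have := tsupport_ballCutoff_subset hR (tsupport_fderiv_subset ℝ h)
      rw [mem_closedBall_zero_iff] at this
      linarith

theorem exists_norm_fderiv_ballCutoff_le :
    ∃ C, ∀ R > 0, ∀ x, ‖fderiv ℝ (ballCutoff R) x‖ ≤ C / R := by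
  let b : ContDiffBump (0 : Plane) := ⟨1, 2, one_pos, one_lt_two⟩
  have hb : ContDiff ℝ 1 b := b.contDiff
  obtain ⟨C, hC⟩ := (hb.continuous_fderiv one_ne_zero).bounded_above_of_compact_support
    (b.hasCompactSupport.fderiv ℝ)
  refine ⟨C, fun R hR x => ?_⟩
  have h1 : HasFDerivAt (fun x : Plane => R⁻¹ • x) (R⁻¹ • ContinuousLinearMap.id ℝ Plane) x :=
    (hasFDerivAt_id x).const_smul R⁻¹
  have h2 := (hb.differentiable one_ne_zero (R⁻¹ • x)).hasFDerivAt.comp x h1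
  have h3 : fderiv ℝ (ballCutoff R) x = R⁻¹ • fderiv ℝ b (R⁻¹ • x) := by
    have h3 : fderiv ℝ (ballCutoff R) x = _ := h2.fderiv
    rw [h3]
    ext y
    simp
  rw [h3, norm_smul, norm_inv, Real.norm_of_nonneg hR.le, div_eq_inv_mul]
  exact mul_le_mul_of_nonneg_left (hC _) (by positivity)

/-- Scale invariant bound of the annular integrals `∫ f ∇φ_R · ∇g` by the bounds of `f` and `g`. -/
theorem exists_abs_integral_ballCutoff_le :
    ∃ C ≥ 0, ∀ R > 0, ∀ (Ω : Set Plane) (f g : Plane → ℝ), IsOpen Ω →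
      ContDiffOn ℝ 1 g Ω → {x | R / 4 ≤ ‖x‖} ⊆ Ω →
      (∀ φ : Plane → ℝ, ContDiff ℝ 1 φ → HasCompactSupport φ → tsupport φ ⊆ Ω →
        ∫ x, fderiv ℝ φ x (gradient g x) = 0) →
      ∀ m > 0, ∀ M ≥ 0, (∀ x, R / 4 ≤ ‖x‖ → ‖x‖ ≤ 4 * R → |f x| ≤ M ∧ |g x| ≤ m) →
      |∫ x, f x * fderiv ℝ (ballCutoff R) x (gradient g x)| ≤ C * (M * m) := by
  obtain ⟨C, hC⟩ := exists_norm_fderiv_ballCutoff_le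
  set b := (volume : Measure Plane).real (Metric.ball 0 1)
  -- Gradients of order 1/R enter squared against an area of order R², so in the plane R drops out.
  -- The factor 6 dominates the gradient of η, bounded by C/(2R) + 4C/R, and (4R)² b is the area of
  -- the disc containing its support.
  refine ⟨5 / 2 * ((6 * C) ^ 2 * (4 ^ 2 * b)), by positivity,
    fun R hR Ω f g hΩ hg hRΩ hdiv m hm M hM hbd => ?_⟩
  have hR2 : 0 < 2 * R := by linarith
  have hR4 : 0 < R / 4 := by linarith
  -- This equals 1 on R ≤ |x| ≤ 2R, where the gradient of `ballCutoff R` lives, and is supported in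
  -- R/4 ≤ |x| ≤ 4R.
  let η : Plane → ℝ := fun x => ballCutoff (2 * R) x - ballCutoff (R / 4) x
  have hη : ContDiff ℝ 1 η :=
    ((contDiff_ballCutoff _).sub (contDiff_ballCutoff _)).of_le (by simp)
  have hηs : tsupport η ⊆ {x | R / 4 ≤ ‖x‖} ∩ Metric.closedBall 0 (4 * R) := by
    refine closure_minimal (fun x hx => ?_)
      ((isClosed_le continuous_const continuous_norm).inter Metric.isClosed_closedBall)
    constructor
    · by_contra h
      have h : ‖x‖ < R / 4 := not_le.1 h
      exact hx (by simp only [η]; rw [ballCutoff_eq_one hR2 (by linarith),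
        ballCutoff_eq_one hR4 h.le, sub_self])
    · by_contra h
      rw [mem_closedBall_zero_iff, not_le] at h
      exact hx (by simp only [η]; rw [ballCutoff_eq_zero hR2 (by linarith),
        ballCutoff_eq_zero hR4 (by linarith), sub_self])
  have hηc : HasCompactSupport η := (isCompact_closedBall 0 (4 * R)).of_isClosed_subset
    (isClosed_tsupport _) (hηs.trans inter_subset_right)
  have hC0 : 0 ≤ C := by
    have := (norm_nonneg _).trans (hC 1 one_pos 0)
    simpa using this
  have hle := abs_integral_mul_fderiv_gradient_le (φ := ballCutoff R) (f := f) hΩ hg hdiv hη hηc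
    (hηs.trans (inter_subset_left.trans hRΩ)) (fun x hx => ?_) hm hM (a := 6 * C / R)
    (fun x => ?_) (fun x => ?_) (fun x hx => ?_) (fun x hx => ?_)
  · refine hle.trans ?_
    have hv : volume.real (tsupport η) ≤ (4 * R) ^ 2 * b := by
      refine (measureReal_mono (hηs.trans inter_subset_right)
        (isCompact_closedBall _ _).measure_lt_top.ne).trans ?_
      rw [Measure.addHaar_real_closedBall _ _ (by positivity)]
      simp [b]
    have h1 : (6 * C / R) ^ 2 * volume.real (tsupport η) ≤ (6 * C) ^ 2 * (4 ^ 2 * b) := by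
      refine (mul_le_mul_of_nonneg_left hv (by positivity)).trans (le_of_eq ?_)
      field_simp
    calc _ ≤ 5 / 2 * M * m * ((6 * C) ^ 2 * (4 ^ 2 * b)) :=
          mul_le_mul_of_nonneg_left h1 (by positivity)
      _ = _ := by ring
  · have h1 : R ≤ ‖x‖ := by
      by_contra h
      exact hx (fderiv_ballCutoff_eq_zero hR (Or.inl (not_le.1 h)))
    have h2 : ‖x‖ ≤ 2 * R := by
      by_contra h
      exact hx (fderiv_ballCutoff_eq_zero hR (Or.inr (not_le.1 h)))
    simp only [η]
    rw [ballCutoff_eq_one hR2 h2, ballCutoff_eq_zero hR4 (by linarith), sub_zero]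
  · refine (hC R hR x).trans ?_
    gcongr
    linarith
  · have h1 : fderiv ℝ η x = fderiv ℝ (ballCutoff (2 * R)) x - fderiv ℝ (ballCutoff (R / 4)) x :=
      fderiv_sub ((contDiff_ballCutoff _).differentiable (by simp) x)
        ((contDiff_ballCutoff _).differentiable (by simp) x)
    rw [h1]
    refine (norm_sub_le _ _).trans ((add_le_add (hC _ hR2 x) (hC _ hR4 x)).trans ?_)
    rw [div_add_div _ _ hR2.ne' hR4.ne', div_le_div_iff₀ (by positivity) hR]
    nlinarith [mul_nonneg hC0 (mul_pos hR hR).le]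
  · have := hηs hx
    exact (hbd x this.1 (mem_closedBall_zero_iff.1 this.2)).1
  · have := hηs hx
    exact (hbd x this.1 (mem_closedBall_zero_iff.1 this.2)).2

end Infinity

/-! ### Behaviour at infinity and reciprocity -/

section Asymptotics

/-- Apply log t ≤ t − 1 to the quotient of the two distances, whose denominator exceeds |x| / 2.
Exchanging a and b gives the other side. -/
theorem log_norm_sub_sub_le {x a b : Plane} (hx : 0 < ‖x‖) (ha : 2 * ‖a‖ < ‖x‖)
    (hb : 2 * ‖b‖ < ‖x‖) :
    Real.log ‖x - a‖ - Real.log ‖x - b‖ ≤ 2 * ‖a - b‖ * ‖x‖⁻¹ := by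
  have h1 : ‖x‖ / 2 < ‖x - a‖ := by linarith [norm_sub_norm_le x a]
  have h2 : ‖x‖ / 2 < ‖x - b‖ := by linarith [norm_sub_norm_le x b]
  have p1 : 0 < ‖x - a‖ := by linarith
  have p2 : 0 < ‖x - b‖ := by linarith
  rw [← Real.log_div p1.ne' p2.ne']
  refine (Real.log_le_sub_one_of_pos (div_pos p1 p2)).trans ?_
  have h3 : ‖x - a‖ - ‖x - b‖ ≤ ‖a - b‖ := by
    have := norm_sub_norm_le (x - a) (x - b)
    rwa [sub_sub_sub_cancel_left, norm_sub_rev b a] at this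
  rw [div_sub_one p2.ne', ← div_eq_mul_inv, div_le_div_iff₀ p2 hx]
  nlinarith [norm_nonneg (a - b)]

theorem fundamentalSolution_sub_isBigO (p q : Plane) :
    (fun x => fundamentalSolution (x - q) - fundamentalSolution (x - p))
      =O[Bornology.cobounded Plane] fun x => ‖x‖⁻¹ := by
  refine Asymptotics.IsBigO.of_bound (1 / (2 * Real.pi) * (2 * ‖p - q‖)) ?_
  filter_upwards [tendsto_norm_cobounded_atTop.eventually
    (eventually_gt_atTop (2 * ‖p‖ + 2 * ‖q‖))] with x hx
  have hp := norm_nonneg p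
  have hq := norm_nonneg q
  have hx0 : 0 < ‖x‖ := by linarith
  have h1 := log_norm_sub_sub_le hx0 (a := p) (b := q) (by linarith) (by linarith)
  have h2 := log_norm_sub_sub_le hx0 (a := q) (b := p) (by linarith) (by linarith)
  rw [norm_sub_rev q p] at h2
  simp only [fundamentalSolution]
  rw [← mul_sub, norm_mul, norm_inv, norm_norm, mul_assoc (1 / (2 * Real.pi)),
    Real.norm_of_nonneg (by positivity)]
  exact mul_le_mul_of_nonneg_left (abs_le.2 ⟨by linarith, h2⟩) (by positivity)

/-- Against the decay |x|⁻¹ of w − u any power below 1 suffices in place of the logarithm; the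
square root comes directly from log √s ≤ √s. -/
theorem fundamentalSolution_isBigO (p : Plane) :
    (fun x => fundamentalSolution (x - p))
      =O[Bornology.cobounded Plane] fun x => √‖x‖ := by
  refine Asymptotics.IsBigO.of_bound (1 / (2 * Real.pi) * 4) ?_
  filter_upwards [tendsto_norm_cobounded_atTop.eventually
    (eventually_gt_atTop (‖p‖ + 1))] with x hx
  have h1 : 1 ≤ ‖x - p‖ := by linarith [norm_sub_norm_le x p]
  have h2 : ‖x - p‖ ≤ 4 * ‖x‖ := by linarith [norm_sub_le x p, norm_nonneg p]
  have h3 : Real.log ‖x - p‖ ≤ 4 * √‖x‖ := by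
    have h4 : Real.log (√‖x - p‖) ≤ √‖x - p‖ := by
      have := Real.log_le_sub_one_of_pos (Real.sqrt_pos.2 (by linarith : 0 < ‖x - p‖))
      linarith
    rw [Real.log_sqrt (norm_nonneg _)] at h4
    have h5 : √‖x - p‖ ≤ 2 * √‖x‖ := by
      refine (Real.sqrt_le_sqrt h2).trans (le_of_eq ?_)
      rw [Real.sqrt_mul (by norm_num), show (4 : ℝ) = 2 ^ 2 by norm_num,
        Real.sqrt_sq (by norm_num)]
    linarith
  simp only [fundamentalSolution]
  rw [norm_mul, mul_assoc, Real.norm_of_nonneg (by positivity : 0 ≤ 1 / (2 * Real.pi)),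
    Real.norm_of_nonneg (Real.log_nonneg h1), Real.norm_of_nonneg (Real.sqrt_nonneg _)]
  exact mul_le_mul_of_nonneg_left h3 (by positivity)

theorem exists_bound_of_isBigO_cobounded {f : Plane → ℝ} {k : ℝ → ℝ} (hk : ∀ t, 0 ≤ k t)
    (h : f =O[Bornology.cobounded Plane] fun x => k ‖x‖) :
    ∃ C > 0, ∃ R₀ : ℝ, ∀ x, R₀ ≤ ‖x‖ → |f x| ≤ C * k ‖x‖ := by
  obtain ⟨C, hC, hb⟩ := h.exists_pos
  obtain ⟨R₀, -, hR₀⟩ := (hasBasis_cobounded_norm (E := Plane)).eventually_iff.1 hb.bound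
  refine ⟨C, hC, R₀, fun x hx => ?_⟩
  have := hR₀ hx
  rwa [Real.norm_eq_abs, Real.norm_of_nonneg (hk _)] at this

variable {κ : ℝ} {D : Set Plane} {p q : Plane} {u w v v' : Plane → ℝ}

theorem IsTransmissionSolution.weakly_harmonic (hD : IsOpen D)
    (hu : IsTransmissionSolution κ D p u) {Ω : Set Plane} (hΩ : Ω ⊆ (closure D)ᶜ \ {p})
    {φ : Plane → ℝ} (hφ : ContDiff ℝ 1 φ) (hφc : HasCompactSupport φ) (hφΩ : tsupport φ ⊆ Ω) :
    ∫ x, fderiv ℝ φ x (gradient u x) = 0 := by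
  have h := hu.weak_equation hD hφ hφc fun x hx h => (hΩ (hφΩ hx)).1 (frontier_subset_closure h)
  rw [image_eq_zero_of_notMem_tsupport fun h => (hΩ (hφΩ h)).2 rfl, neg_eq_zero] at h
  rw [← h]
  refine integral_congr_ae (Eventually.of_forall fun x => ?_)
  simp only
  by_cases hx : x ∈ tsupport φ
  · rw [current, conductivity_of_notMem fun h => (hΩ (hφΩ hx)).1 (subset_closure h), one_smul]
  · rw [image_eq_zero_of_notMem_tsupport fun h => hx (tsupport_fderiv_subset ℝ h)]
    simp

/-- There is no contribution of infinity to Green's identity. -/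
theorem tendsto_integral_greenField_ballCutoff (hD : IsBoundedC2Domain D)
    (hu : IsTransmissionSolution κ D p u)
    (hw : IsTransmissionSolution κ D q w) (hvu : EqOn v u (frontier D ∪ {p})ᶜ)
    (hvw : EqOn v' w (frontier D ∪ {q})ᶜ) :
    Tendsto (fun R => ∫ x, fderiv ℝ (ballCutoff R) x (greenField κ D u w v v' x)) atTop (𝓝 0) := by
  -- bounds of `u` and `w - u` at infinity
  have bd : (fun x => w x - u x) =O[Bornology.cobounded Plane] fun x => ‖x‖⁻¹ := by
    refine ((hw.decay.sub hu.decay).add (fundamentalSolution_sub_isBigO p q)).congr_left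
      fun x => ?_
    ring
  have bu : u =O[Bornology.cobounded Plane] fun x => √‖x‖ := by
    have h1 : (fun x : Plane => ‖x‖⁻¹) =O[Bornology.cobounded Plane] fun x => √‖x‖ := by
      refine Asymptotics.IsBigO.of_bound 1 ?_
      filter_upwards [tendsto_norm_cobounded_atTop.eventually (eventually_ge_atTop 1)] with x hx
      rw [Real.norm_of_nonneg (by positivity), Real.norm_of_nonneg (by positivity), one_mul]
      exact (inv_le_one_of_one_le₀ hx).trans (Real.one_le_sqrt.2 hx)
    refine ((hu.decay.trans h1).add (fundamentalSolution_isBigO p)).congr_left fun x => ?_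
    ring
  obtain ⟨C₁, hC₁, R₁, h₁⟩ := exists_bound_of_isBigO_cobounded (k := fun t => √t)
    (fun t => Real.sqrt_nonneg t) bu
  -- The absolute value makes k nonnegative on all of ℝ; on norms it changes nothing.
  obtain ⟨C₂, hC₂, R₂, h₂⟩ := exists_bound_of_isBigO_cobounded (k := fun t => |t|⁻¹)
    (fun t => by positivity) (by simpa using bd)
  obtain ⟨R₃, h₃⟩ := (hD.isBounded.closure.union
    (toFinite ({p, q} : Set Plane)).isBounded).exists_norm_le
  obtain ⟨C, hC, hest⟩ := exists_abs_integral_ballCutoff_le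
  set Ω : Set Plane := {x | R₃ < ‖x‖} with hΩdef
  have hΩ : IsOpen Ω := isOpen_lt continuous_const continuous_norm
  have hΩp : Ω ⊆ (closure D)ᶜ \ {p} := fun x hx =>
    ⟨fun h => absurd (h₃ x (Or.inl h)) (not_le.2 hx),
      fun h => absurd (h₃ x (Or.inr (Or.inl h))) (not_le.2 hx)⟩
  have hΩq : Ω ⊆ (closure D)ᶜ \ {q} := fun x hx =>
    ⟨fun h => absurd (h₃ x (Or.inl h)) (not_le.2 hx),
      fun h => absurd (h₃ x (Or.inr (Or.inr h))) (not_le.2 hx)⟩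
  have hfc : (closure D)ᶜ ⊆ (frontier D)ᶜ := compl_subset_compl.2 frontier_subset_closure
  have hup : Ω ⊆ (frontier D ∪ {p})ᶜ := fun x hx h => h.elim (hfc (hΩp hx).1) (hΩp hx).2
  have hwq : Ω ⊆ (frontier D ∪ {q})ᶜ := fun x hx h => h.elim (hfc (hΩq hx).1) (hΩq hx).2
  have hu1 : ContDiffOn ℝ 1 u Ω := (hu.contDiffOn.of_le (by norm_num)).mono hup
  have hw1 : ContDiffOn ℝ 1 w Ω := (hw.contDiffOn.of_le (by norm_num)).mono hwq
  have hd1 : ContDiffOn ℝ 1 (fun x => w x - u x) Ω := hw1.sub hu1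
  have gd : ∀ x ∈ Ω, gradient (fun x => w x - u x) x = gradient w x - gradient u x := by
    intro x hx
    have dw := (hw1.contDiffAt (hΩ.mem_nhds hx)).differentiableAt one_ne_zero
    have du := (hu1.contDiffAt (hΩ.mem_nhds hx)).differentiableAt one_ne_zero
    simp only [gradient]
    rw [fderiv_fun_sub dw du, map_sub]
  have hu2 : ∀ φ : Plane → ℝ, ContDiff ℝ 1 φ → HasCompactSupport φ → tsupport φ ⊆ Ω →
      ∫ x, fderiv ℝ φ x (gradient u x) = 0 := fun φ hφ hφc hφΩ =>
    hu.weakly_harmonic hD.isOpen hΩp hφ hφc hφΩ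
  have lu := (hu1.continuousOn_gradient hΩ).locallyIntegrableOn (μ := volume) hΩ.measurableSet
  have lw := (hw1.continuousOn_gradient hΩ).locallyIntegrableOn (μ := volume) hΩ.measurableSet
  have hd2 : ∀ φ : Plane → ℝ, ContDiff ℝ 1 φ → HasCompactSupport φ → tsupport φ ⊆ Ω →
      ∫ x, fderiv ℝ φ x (gradient (fun x => w x - u x) x) = 0 := by
    intro φ hφ hφc hφΩ
    have e1 := hu2 φ hφ hφc hφΩ
    have e2 := hw.weakly_harmonic hD.isOpen hΩq hφ hφc hφΩ
    rw [← sub_eq_zero.2 (e2.trans e1.symm), ← integral_sub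
      (integrable_fderiv_apply_of_locallyIntegrableOn lw hφ hφc hφΩ)
      (integrable_fderiv_apply_of_locallyIntegrableOn lu hφ hφc hφΩ)]
    refine integral_congr_ae (Eventually.of_forall fun x => ?_)
    simp only
    by_cases hx : x ∈ tsupport φ
    · rw [gd x (hφΩ hx), map_sub]
    · rw [image_eq_zero_of_notMem_tsupport fun h => hx (tsupport_fderiv_subset ℝ h)]
      simp
  have ev : ∀ᶠ R : ℝ in atTop,
      ‖∫ x, fderiv ℝ (ballCutoff R) x (greenField κ D u w v v' x)‖ ≤
        2 * C * (C₁ * C₂ * 8) * (√R)⁻¹ := by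
    filter_upwards [eventually_gt_atTop 0, eventually_gt_atTop (4 * R₁),
      eventually_gt_atTop (4 * R₂), eventually_gt_atTop (4 * R₃)] with R hR hR1 hR2 hR3
    have hφ : ContDiff ℝ 1 (ballCutoff R) := (contDiff_ballCutoff R).of_le (by simp)
    have hφs : tsupport (fderiv ℝ (ballCutoff R)) ⊆ Ω := by
      have : tsupport (fderiv ℝ (ballCutoff R)) ⊆ {x | R ≤ ‖x‖} := by
        refine closure_minimal (fun x hx => ?_) (isClosed_le continuous_const continuous_norm)
        by_contra h
        exact hx (fderiv_ballCutoff_eq_zero hR (Or.inl (not_le.1 h)))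
      exact this.trans fun x hx => lt_of_lt_of_le (by linarith : R₃ < R) hx
    have int : ∀ f g : Plane → ℝ, ContDiffOn ℝ 1 f Ω → ContDiffOn ℝ 1 g Ω →
        Integrable (fun x => f x * fderiv ℝ (ballCutoff R) x (gradient g x)) := by
      intro f g hf hg
      refine (integrable_apply_of_locallyIntegrableOn (X := fun x => f x • gradient g x)
        ((hf.continuousOn.smul (hg.continuousOn_gradient hΩ)).locallyIntegrableOn
          hΩ.measurableSet) (hφ.continuous_fderiv one_ne_zero)
        ((hasCompactSupport_ballCutoff hR).fderiv ℝ) hφs).congr (Eventually.of_forall fun x => ?_)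
      simp
    -- Subtracting and adding u∇u leaves w − u in both terms, once differentiated and once not. The
    -- bounds 2C₁√R and 4C₂/R multiply to 8C₁C₂/√R in each.
    have split : ∫ x, fderiv ℝ (ballCutoff R) x (greenField κ D u w v v' x) =
        (∫ x, u x * fderiv ℝ (ballCutoff R) x (gradient (fun x => w x - u x) x)) -
        ∫ x, (w x - u x) * fderiv ℝ (ballCutoff R) x (gradient u x) := by
      rw [← integral_sub (int _ _ hu1 hd1) (int _ _ hd1 hu1)]
      refine integral_congr_ae (Eventually.of_forall fun x => ?_)
      simp only
      by_cases hx : x ∈ Ω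
      · have hxD : x ∉ D := fun h => (hΩp hx).1 (subset_closure h)
        rw [gd x hx, greenField, hvu (hup hx), hvw (hwq hx), current, current,
          conductivity_of_notMem hxD]
        simp only [one_smul, map_sub, map_smul, smul_eq_mul]
        ring
      · rw [image_eq_zero_of_notMem_tsupport fun h => hx (hφs h)]
        simp
    have bdu : ∀ x : Plane, R / 4 ≤ ‖x‖ → ‖x‖ ≤ 4 * R → |u x| ≤ C₁ * (2 * √R) := by
      intro x hx1 hx2
      refine (h₁ x (by linarith)).trans (mul_le_mul_of_nonneg_left ?_ hC₁.le)
      refine (Real.sqrt_le_sqrt hx2).trans (le_of_eq ?_)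
      rw [Real.sqrt_mul (by norm_num), show (4 : ℝ) = 2 ^ 2 by norm_num,
        Real.sqrt_sq (by norm_num)]
    have bdd : ∀ x : Plane, R / 4 ≤ ‖x‖ → ‖x‖ ≤ 4 * R → |w x - u x| ≤ C₂ * (4 / R) := by
      intro x hx1 hx2
      refine (h₂ x (by linarith)).trans (mul_le_mul_of_nonneg_left ?_ hC₂.le)
      simp only [abs_norm]
      rw [← inv_div]
      exact inv_anti₀ (by positivity) hx1
    have hsub : {x : Plane | R / 4 ≤ ‖x‖} ⊆ Ω := fun x hx =>
      lt_of_lt_of_le (by linarith : R₃ < R / 4) hx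
    have sR : 0 < √R := Real.sqrt_pos.2 hR
    have e1 := hest R hR Ω u _ hΩ hd1 hsub hd2 (C₂ * (4 / R)) (by positivity) (C₁ * (2 * √R))
      (by positivity) fun x h h' => ⟨bdu x h h', bdd x h h'⟩
    have e2 := hest R hR Ω (fun x => w x - u x) u hΩ hu1 hsub hu2 (C₁ * (2 * √R)) (by positivity)
      (C₂ * (4 / R)) (by positivity) fun x h h' => ⟨bdd x h h', bdu x h h'⟩
    rw [split]
    refine (norm_sub_le _ _).trans ((add_le_add e1 e2).trans (le_of_eq ?_))
    have : R = √R * √R := (Real.mul_self_sqrt hR.le).symm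
    field_simp
    rw [sq, ← this]
    ring
  refine squeeze_zero_norm' ev ?_
  simpa using (tendsto_inv_atTop_zero.comp Real.tendsto_sqrt_atTop).const_mul
    (2 * C * (C₁ * C₂ * 8))

/-- **Reciprocity.** -/
theorem IsTransmissionSolution.reciprocity (hD : IsBoundedC2Domain D) (hp : p ∉ closure D)
    (hq : q ∉ closure D) (hpq : p ≠ q) (hu : IsTransmissionSolution κ D p u)
    (hw : IsTransmissionSolution κ D q w) : u q = w p := by
  obtain ⟨v, hv, hvu⟩ := hu.exists_continuousOn hD hp
  obtain ⟨v', hv', hvw⟩ := hw.exists_continuousOn hD hq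
  have hco : IsOpen (closure D)ᶜ := isClosed_closure.isOpen_compl
  obtain ⟨η₁, hη₁, hη₁c, hη₁Ω, hη₁1, -⟩ := (isCompact_singleton (x := p)).exists_smooth_cutoff
    (hco.sdiff (isClosed_singleton (x := q))) (singleton_subset_iff.2 ⟨hp, hpq⟩)
  obtain ⟨η₂, hη₂, hη₂c, hη₂Ω, hη₂1, -⟩ := (isCompact_singleton (x := q)).exists_smooth_cutoff
    (hco.sdiff (isClosed_singleton (x := p))) (singleton_subset_iff.2 ⟨hq, hpq.symm⟩)
  rw [nhdsSet_singleton] at hη₁1 hη₂1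
  have hη₁' : ContDiff ℝ 1 η₁ := hη₁.of_le (by simp)
  have hη₂' : ContDiff ℝ 1 η₂ := hη₂.of_le (by simp)
  obtain ⟨i1, e1⟩ := integral_greenField_source hD hp hu hw hvu hvw hη₁' hη₁c hη₁Ω hη₁1
  -- At q the roles of the potentials are exchanged; antisymmetry of the Green field turns the
  -- contribution u(q) into −u(q).
  obtain ⟨i2, e2⟩ := integral_greenField_source hD hq hw hu hvw hvu hη₂' hη₂c hη₂Ω hη₂1
  simp only [greenField_swap (u := u), map_neg] at i2 e2
  rw [integral_neg] at e2
  have i2 := i2.neg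
  simp only [Pi.neg_def, neg_neg] at i2
  obtain ⟨R₀, hR₀⟩ := (toFinite ({p, q} : Set Plane)).isBounded.exists_norm_le
  have ev : ∀ᶠ R : ℝ in atTop,
      ∫ x, fderiv ℝ (ballCutoff R) x (greenField κ D u w v v' x) = w p - u q := by
    filter_upwards [eventually_gt_atTop 0, eventually_gt_atTop R₀] with R hR hRR
    -- All three cutoffs are locally constant near the sources and cancel there, so Green's identity
    -- applies to φ. The annular integral thus equals w(p) − u(q) for every large R, while it tends
    -- to zero.
    let φ : Plane → ℝ := fun x => ballCutoff R x - (η₁ x + η₂ x)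
    have hb : ContDiff ℝ 1 (ballCutoff R) := (contDiff_ballCutoff R).of_le (by simp)
    have hφ : ContDiff ℝ 1 φ := hb.sub (hη₁'.add hη₂')
    have hφc : HasCompactSupport φ := (hasCompactSupport_ballCutoff hR).sub (hη₁c.add hη₂c)
    have near : ∀ z, ‖z‖ ≤ R₀ → ∀ᶠ x in 𝓝 z, ballCutoff R x = 1 := by
      intro z hz
      filter_upwards [(isOpen_lt continuous_norm continuous_const).mem_nhds
        (lt_of_le_of_lt hz hRR)] with x hx
      exact ballCutoff_eq_one hR (le_of_lt hx)
    have hφΩ : tsupport φ ⊆ {p, q}ᶜ := by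
      rintro x hx (rfl | hxq)
      · refine notMem_tsupport_iff_eventuallyEq.2 ?_ hx
        filter_upwards [near x (hR₀ x (Or.inl rfl)), hη₁1,
          notMem_tsupport_iff_eventuallyEq.1 fun h => (hη₂Ω h).2 rfl] with y h1 h2 h3
        simp [φ, h1, h2, h3]
      · have hxq : x = q := hxq
        subst hxq
        refine notMem_tsupport_iff_eventuallyEq.2 ?_ hx
        filter_upwards [near x (hR₀ x (Or.inr rfl)), hη₂1,
          notMem_tsupport_iff_eventuallyEq.1 fun h => (hη₁Ω h).2 rfl] with y h1 h2 h3
        simp [φ, h1, h2, h3]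
    have e0 := integral_greenField hD hp hq hu hw hv hv' hvu hvw hφ hφc hφΩ
    have i0 := integrable_fderiv_apply_of_locallyIntegrableOn
      (locallyIntegrableOn_greenField hD hp hq hu hw hv hv') hφ hφc hφΩ
    have hsum : ∀ x, fderiv ℝ (ballCutoff R) x (greenField κ D u w v v' x) =
        fderiv ℝ φ x (greenField κ D u w v v' x) +
        (fderiv ℝ η₁ x (greenField κ D u w v v' x) +
          fderiv ℝ η₂ x (greenField κ D u w v v' x)) := by
      intro x
      have d1 := hb.differentiable one_ne_zero x
      have d2 := hη₁'.differentiable one_ne_zero x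
      have d3 := hη₂'.differentiable one_ne_zero x
      have : fderiv ℝ φ x = fderiv ℝ (ballCutoff R) x - (fderiv ℝ η₁ x + fderiv ℝ η₂ x) :=
        (d1.hasFDerivAt.sub (d2.hasFDerivAt.add d3.hasFDerivAt)).fderiv
      rw [this]
      simp
    have i12 : Integrable (fun x => fderiv ℝ η₁ x (greenField κ D u w v v' x) +
        fderiv ℝ η₂ x (greenField κ D u w v v' x)) := i1.add i2
    simp_rw [hsum]
    rw [integral_add i0 i12, integral_add i1 i2, e0, e1]
    linarith
  have := tendsto_nhds_unique (tendsto_integral_greenField_ballCutoff hD hu hw hvu hvw)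
    (tendsto_const_nhds.congr' (EventuallyEq.symm ev))
  linarith

end Asymptotics

theorem fundamentalSolution_sub_comm (x y : Plane) :
    fundamentalSolution (x - y) = fundamentalSolution (y - x) := by
  rw [fundamentalSolution, fundamentalSolution, norm_sub_rev]

/-- Diagonal entries play no role in symmetry; off the diagonal it follows from reciprocity and the
evenness of Γ. -/
theorem mainTheorem6 (κ : ℝ) (hκ : 1 < κ) (D : Set Plane) (hD : IsBoundedC2Domain D)
    (N : ℕ) (x : Fin N → Plane) (hx : Function.Injective x) (hxD : ∀ s, x s ∉ closure D)
    (u : Fin N → Plane → ℝ) (hu : ∀ s, IsTransmissionSolution κ D (x s) (u s)) :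
    (∀ r s, u s (x r) = u r (x s)) ∧ (multistaticResponse x u).IsSymm := by
  have h : ∀ r s, u s (x r) = u r (x s) := by
    intro r s
    rcases eq_or_ne r s with rfl | hrs
    · rfl
    · exact (hu s).reciprocity hD (hxD s) (hxD r) (fun h => hrs (hx h).symm) (hu r)
  refine ⟨h, Matrix.IsSymm.ext fun r s => ?_⟩
  simp only [multistaticResponse, Matrix.of_apply]
  rcases eq_or_ne r s with rfl | hrs
  · rfl
  · rw [if_neg hrs, if_neg hrs.symm, h, fundamentalSolution_sub_comm]
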